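/- Let the scalar field be $\mathbb{R}$ or $\mathbb{C}$. For a normed space $X$ and a sequence $(f_n)_{n\ge 1}$ in $X^*$ put $$\beta\big((f_n)\big)=\sup\Big\{\limsup_{n\to\infty}|\langle f_n,x_n\rangle| : (x_n)_{n\ge1}\subseteq B_X \text{ weakly null}\Big\},$$ where $B_X$ is the closed unit ball of $X$. A sequence $(g_n)_{n\ge1}$ is a convex block subsequence of $(f_n)_{n\ge1}$ if there are integers $0=k_0<k_1<k_2<\cdots$ such that $g_n$ lies in the convex hull of $\{f_i : k_{n-1}<i\le k_n\}$ for every $n\ge 1$; let $\operatorname{cbs}((f_n))$ be the set of all convex block subsequences of $(f_n)$. Define $$K_2(X)=\sup_{\substack{(f_n)\subseteq B_{X^*}\\ \text{weak* null}}}\ \inf_{(g_n)\in\operatorname{cbs}((f_n))}\beta\big((g_n)\big).$$ (a) Let $X$ be a Banach space such that $B_{X^*}$ is weak* sequentially compact or $X$ contains no closed subspace isomorphic to $\ell_1$. If $X$ contains a closed subspace isomorphic to $c_0$, then $K_2(X)=1$. In particular, $K_2(c_0)=K_2(c)=K_2(C[0,1])=1$. (b) If $I$ is an index set of cardinality continuum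 (for instance $I=\mathbb{R}$), then $K_2\big(\ell_1(I,L_1[0,1])\big)=1$, where $\ell_1(I,L_1[0,1])$ denotes the $\ell_1$-sum of $|I|$ copies of $L_1[0,1]$. -/

import Mathlib

open Filter Topology
open scoped ENNReal ZeroAtInfty

/-- `g` is a convex block subsequence of `f`: there are block ends `0 = k 0 < k 1 < k 2 < ⋯` such
that `g n` is a convex combination of the `f i` with `k n ≤ i < k (n + 1)`
(sequences are indexed from `0`). -/
def IsConvexBlockSubseq {E : Type*} [AddCommGroup E] [Module ℝ E] (g f : ℕ → E) : Prop :=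
  ∃ k : ℕ → ℕ, k 0 = 0 ∧ StrictMono k ∧
    ∀ n, g n ∈ convexHull ℝ (f '' Set.Ico (k n) (k (n + 1)))

section Quantities

variable (𝕜 : Type*) [RCLike 𝕜] (X : Type*) [NormedAddCommGroup X] [NormedSpace 𝕜 X]

/-- The weakly null sequences in the closed unit ball of `X`. -/
def weaklyNullBall : Set (ℕ → X) :=
  {x | (∀ n, ‖x n‖ ≤ 1) ∧ Tendsto (fun n => toWeakSpace 𝕜 X (x n)) atTop (𝓝 0)}

/-- The weak* null sequences in the closed unit ball of the dual of `X`. -/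
def weakStarNullBall : Set (ℕ → StrongDual 𝕜 X) :=
  {f | (∀ n, ‖f n‖ ≤ 1) ∧ Tendsto (fun n => StrongDual.toWeakDual (f n)) atTop (𝓝 0)}

/-- `β(f)`: the supremum of `limsup |⟨f n, x n⟩|` over all weakly null sequences `x` in the closed
unit ball of `X`. -/
noncomputable def betaQuantity (f : ℕ → StrongDual 𝕜 X) : ℝ≥0∞ :=
  ⨆ x ∈ weaklyNullBall 𝕜 X, limsup (fun n => ‖f n (x n)‖ₑ) atTop

/-- `K₂(X)`: the supremum, over all weak* null sequences `f` in the closed unit ball of the dual, of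
the infimum of `β(g)` over all convex block subsequences `g` of `f`. -/
noncomputable def K₂ : ℝ≥0∞ :=
  ⨆ f ∈ weakStarNullBall 𝕜 X,
    ⨅ g ∈ {g : ℕ → StrongDual 𝕜 X | IsConvexBlockSubseq g f}, betaQuantity 𝕜 X g

/-- `X` contains a (closed linear) subspace isomorphic to `E`. -/
def ContainsCopy (E : Type*) [NormedAddCommGroup E] [NormedSpace 𝕜 E] : Prop :=
  ∃ Y : Submodule 𝕜 X, IsClosed (Y : Set X) ∧ Nonempty (E ≃L[𝕜] Y)

/-- The closed unit ball of the dual of `X` is weak* sequentially compact. -/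
def DualBallWeakStarSeqCompact : Prop :=
  IsSeqCompact {f : WeakDual 𝕜 X | ‖WeakDual.toStrongDual f‖ ≤ 1}

end Quantities

section Spaces

variable (𝕜 : Type*) [RCLike 𝕜]

/-- The space `ℓ₁` of absolutely summable scalar sequences. -/
abbrev EllOne : Type _ := lp (fun _ : ℕ => 𝕜) 1

/-- The space `c₀` of null scalar sequences with the supremum norm. -/
abbrev SeqNull : Type _ := C₀(ℕ, 𝕜)

/-- The space `c` of convergent scalar sequences with the supremum norm, as a subspace of `ℓ∞`. -/
def SeqConv : Submodule 𝕜 (lp (fun _ : ℕ => 𝕜) ∞) where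
  carrier := {x | ∃ l : 𝕜, Tendsto (fun n => x n) atTop (𝓝 l)}
  zero_mem' := ⟨0, tendsto_const_nhds⟩
  add_mem' := by
    rintro x y ⟨a, ha⟩ ⟨b, hb⟩
    exact ⟨a + b, ha.add hb⟩
  smul_mem' := by
    rintro c x ⟨a, ha⟩
    exact ⟨c • a, ha.const_smul c⟩

/-- The space `L₁[0,1]` with respect to Lebesgue measure. -/
abbrev LOneUnit : Type _ :=
  MeasureTheory.Lp 𝕜 1 (MeasureTheory.volume : MeasureTheory.Measure unitInterval)

/-- The `ℓ₁`-sum of copies of `L₁[0,1]` indexed by `ι`. -/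
abbrev EllOneSumLOne (ι : Type*) : Type _ := lp (fun _ : ι => LOneUnit 𝕜) 1

end Spaces

/-- The index of the block `[k j, k (j + 1))` that contains `i`. -/
def blockIndex (k : ℕ → ℕ) (i : ℕ) : ℕ :=
  Nat.findGreatest (fun j => k j ≤ i) i

theorem blockIndex_eq {k : ℕ → ℕ} (hk : StrictMono k) {i j : ℕ}
    (hi : i ∈ Finset.Ico (k j) (k (j + 1))) : blockIndex k i = j := by
  rw [Finset.mem_Ico] at hi
  rw [blockIndex, Nat.findGreatest_eq_iff]
  refine ⟨(hk.id_le j).trans hi.1, fun _ => hi.1, fun n hn _ h => ?_⟩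
  have : k (j + 1) ≤ k n := hk.monotone hn
  omega

theorem le_blockIndex {k : ℕ → ℕ} (hk : StrictMono k) {i j : ℕ} (h : k j ≤ i) :
    j ≤ blockIndex k i :=
  Nat.le_findGreatest ((hk.id_le j).trans h) h

theorem tendsto_blockIndex {k : ℕ → ℕ} (hk : StrictMono k) :
    Tendsto (blockIndex k) atTop atTop :=
  tendsto_atTop.2 fun j => (eventually_ge_atTop (k j)).mono fun _ => le_blockIndex hk

theorem sum_Ico_blocks {M : Type*} [AddCommMonoid M] {k : ℕ → ℕ} (hk : Monotone k) {p q : ℕ}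
    (hpq : p ≤ q) (F : ℕ → M) :
    ∑ j ∈ Finset.Ico p q, ∑ i ∈ Finset.Ico (k j) (k (j + 1)), F i
      = ∑ i ∈ Finset.Ico (k p) (k q), F i := by
  induction q, hpq using Nat.le_induction with
  | base => simp
  | succ q hq ih =>
    rw [Finset.sum_Ico_succ_top hq, ih, Finset.sum_Ico_consecutive _ (hk hq) (hk q.le_succ)]

section Blocks

variable (𝕜 : Type*) [RCLike 𝕜] {E : Type*} [AddCommGroup E] [Module 𝕜 E]

/-- The combinations of the `f i`, `p ≤ i < q`, whose coefficients have `ℓ₁`-norm one. -/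
def ellOneBlock (f : ℕ → E) (p q : ℕ) : Set E :=
  {v | ∃ a : ℕ → 𝕜, ∑ i ∈ Finset.Ico p q, ‖a i‖ = 1 ∧ v = ∑ i ∈ Finset.Ico p q, a i • f i}

/-- `g` is an `ℓ₁`-normalised block sequence of `f`. -/
def IsEllOneBlockSeq (g f : ℕ → E) : Prop :=
  ∃ k : ℕ → ℕ, StrictMono k ∧ ∀ n, g n ∈ ellOneBlock 𝕜 f (k n) (k (n + 1))

variable {𝕜}

theorem sum_Ico_smul_blocks {k : ℕ → ℕ} (hk : StrictMono k) {p q : ℕ} (hpq : p ≤ q)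
    {f g : ℕ → E} {a : ℕ → ℕ → 𝕜}
    (hg : ∀ j ∈ Finset.Ico p q, g j = ∑ i ∈ Finset.Ico (k j) (k (j + 1)), a j i • f i)
    (b : ℕ → 𝕜) :
    ∑ j ∈ Finset.Ico p q, b j • g j = ∑ i ∈ Finset.Ico (k p) (k q),
      (b (blockIndex k i) * a (blockIndex k i) i) • f i := by
  rw [← sum_Ico_blocks hk.monotone hpq]
  refine Finset.sum_congr rfl fun j hj => ?_
  rw [hg j hj, Finset.smul_sum]
  refine Finset.sum_congr rfl fun i hi => ?_
  rw [blockIndex_eq hk hi, smul_smul]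

theorem mem_ellOneBlock_trans {k : ℕ → ℕ} (hk : StrictMono k) {p q : ℕ} {f g : ℕ → E}
    (hg : ∀ j ∈ Finset.Ico p q, g j ∈ ellOneBlock 𝕜 f (k j) (k (j + 1))) {v : E}
    (hv : v ∈ ellOneBlock 𝕜 g p q) : v ∈ ellOneBlock 𝕜 f (k p) (k q) := by
  obtain ⟨b, hb, rfl⟩ := hv
  have hpq : p ≤ q := by
    by_contra h
    rw [Finset.Ico_eq_empty (fun h' => h h'.le)] at hb
    simp at hb
  have hg' : ∀ j, ∃ a : ℕ → 𝕜, j ∈ Finset.Ico p q →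
      ∑ i ∈ Finset.Ico (k j) (k (j + 1)), ‖a i‖ = 1 ∧
      g j = ∑ i ∈ Finset.Ico (k j) (k (j + 1)), a i • f i := fun j => by
    by_cases hj : j ∈ Finset.Ico p q
    · obtain ⟨a, ha⟩ := hg j hj
      exact ⟨a, fun _ => ha⟩
    · exact ⟨0, fun h => absurd h hj⟩
  choose a ha using hg'
  refine ⟨_, ?_, sum_Ico_smul_blocks hk hpq (fun j hj => (ha j hj).2) b⟩
  rw [← sum_Ico_blocks hk.monotone hpq, ← hb]
  refine Finset.sum_congr rfl fun j hj => ?_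
  rw [← mul_one ‖b j‖, ← (ha j hj).1, Finset.mul_sum]
  refine Finset.sum_congr rfl fun i hi => ?_
  rw [blockIndex_eq hk hi, norm_mul]

theorem ellOneBlock_mono {f : ℕ → E} {p p' q q' : ℕ} (hp : p' ≤ p) (hq : q ≤ q') :
    ellOneBlock 𝕜 f p q ⊆ ellOneBlock 𝕜 f p' q' := by
  rintro v ⟨a, ha, rfl⟩
  have hs : Finset.Ico p q ⊆ Finset.Ico p' q' := Finset.Ico_subset_Ico hp hq
  refine ⟨fun i => if i ∈ Finset.Ico p q then a i else 0, ?_, ?_⟩ <;> dsimp only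
  · rw [← ha, ← Finset.sum_subset hs fun i _ hi => by rw [if_neg hi, norm_zero]]
    exact Finset.sum_congr rfl fun i hi => by rw [if_pos hi]
  · rw [← Finset.sum_subset hs fun i _ hi => by rw [if_neg hi, zero_smul]]
    exact Finset.sum_congr rfl fun i hi => by rw [if_pos hi]

theorem self_mem_ellOneBlock (f : ℕ → E) (n : ℕ) : f n ∈ ellOneBlock 𝕜 f n (n + 1) :=
  ⟨1, by simp, by simp⟩

theorem IsEllOneBlockSeq.trans {f g h : ℕ → E} (hhg : IsEllOneBlockSeq 𝕜 h g)
    (hgf : IsEllOneBlockSeq 𝕜 g f) : IsEllOneBlockSeq 𝕜 h f := by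
  obtain ⟨m, hm, hh⟩ := hhg
  obtain ⟨k, hk, hg⟩ := hgf
  exact ⟨k ∘ m, hk.comp hm, fun n => mem_ellOneBlock_trans hk (fun j _ => hg j) (hh n)⟩

theorem IsEllOneBlockSeq.refl (f : ℕ → E) : IsEllOneBlockSeq 𝕜 f f :=
  ⟨id, strictMono_id, self_mem_ellOneBlock f⟩

theorem isEllOneBlockSeq_subseq (f : ℕ → E) {φ : ℕ → ℕ} (hφ : StrictMono φ) :
    IsEllOneBlockSeq 𝕜 (f ∘ φ) f :=
  ⟨φ, hφ, fun n => ellOneBlock_mono le_rfl (hφ n.lt_succ_self) (self_mem_ellOneBlock f (φ n))⟩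

theorem isEllOneBlockSeq_half_sub (f : ℕ → E) :
    IsEllOneBlockSeq 𝕜 (fun n => (2⁻¹ : 𝕜) • (f (2 * n) - f (2 * n + 1))) f := by
  refine ⟨fun n => 2 * n, strictMono_mul_left_of_pos two_pos, fun n =>
    ⟨fun i => if i = 2 * n then 2⁻¹ else -2⁻¹, ?_, ?_⟩⟩ <;>
    dsimp only
  · rw [show 2 * (n + 1) = 2 * n + 1 + 1 by ring, Finset.sum_Ico_succ_top (by omega),
      Finset.sum_Ico_succ_top (by omega)]
    simp
    norm_num
  · rw [show 2 * (n + 1) = 2 * n + 1 + 1 by ring, Finset.sum_Ico_succ_top (by omega),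
      Finset.sum_Ico_succ_top (by omega)]
    simp [sub_eq_add_neg]

theorem norm_le_of_mem_ellOneBlock {E : Type*} [SeminormedAddCommGroup E] [NormedSpace 𝕜 E]
    {f : ℕ → E} {p q : ℕ} {c : ℝ} (hf : ∀ i, p ≤ i → ‖f i‖ ≤ c) {v : E}
    (hv : v ∈ ellOneBlock 𝕜 f p q) : ‖v‖ ≤ c := by
  obtain ⟨a, ha, rfl⟩ := hv
  calc ‖∑ i ∈ Finset.Ico p q, a i • f i‖ ≤ ∑ i ∈ Finset.Ico p q, ‖a i‖ * c :=
        norm_sum_le_of_le _ fun i hi => by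
          rw [norm_smul]
          exact mul_le_mul_of_nonneg_left (hf i (Finset.mem_Ico.1 hi).1) (norm_nonneg _)
    _ = c := by rw [← Finset.sum_mul, ha, one_mul]

theorem map_mem_ellOneBlock {F : Type*} [AddCommGroup F] [Module 𝕜 F] (T : E →ₗ[𝕜] F)
    {f : ℕ → E} {p q : ℕ} {v : E} (hv : v ∈ ellOneBlock 𝕜 f p q) :
    T v ∈ ellOneBlock 𝕜 (fun i => T (f i)) p q := by
  obtain ⟨a, ha, rfl⟩ := hv
  exact ⟨a, ha, by simp⟩

end Blocks

section Test

variable {𝕜 : Type*} [RCLike 𝕜] {X : Type*} [NormedAddCommGroup X] [NormedSpace 𝕜 X]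

theorem tendsto_toWeakSpace_zero_iff {x : ℕ → X} :
    Tendsto (fun n => toWeakSpace 𝕜 X (x n)) atTop (𝓝 0) ↔
      ∀ φ : StrongDual 𝕜 X, Tendsto (fun n => φ (x n)) atTop (𝓝 0) := by
  have hinj : Function.Injective (topDualPairing 𝕜 X).flip := by
    intro a b hab
    refine (SeparatingDual.eq_iff_forall_dual_eq (R := 𝕜)).2 fun φ => ?_
    exact LinearMap.congr_fun hab φ
  refine (WeakBilin.tendsto_iff_forall_eval_tendsto _ hinj).trans ?_
  refine forall_congr' fun φ => ?_
  have : ((topDualPairing 𝕜 X).flip (0 : X)) φ = 0 := map_zero φ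
  exact iff_of_eq (congrArg _ (congrArg _ this))

theorem tendsto_toWeakDual_zero_iff {f : ℕ → StrongDual 𝕜 X} :
    Tendsto (fun n => StrongDual.toWeakDual (f n)) atTop (𝓝 0) ↔
      ∀ x, Tendsto (fun n => f n x) atTop (𝓝 0) :=
  tendsto_iff_forall_eval_tendsto_topDualPairing

theorem K₂_le_one : K₂ 𝕜 X ≤ 1 := by
  refine iSup₂_le fun f hf => iInf₂_le_of_le f
    ⟨id, rfl, strictMono_id, fun n => subset_convexHull ℝ _ ⟨n, by simp, rfl⟩⟩ ?_
  refine iSup₂_le fun x hx => limsup_le_of_le (h := .of_forall fun n => ?_)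
  rw [← ofReal_norm, ENNReal.ofReal_le_one]
  exact ((f n).le_opNorm _).trans (mul_le_one₀ (hf.1 n) (norm_nonneg _) (hx.1 n))

theorem ofReal_le_K₂_of_test {c : ℝ} {f : ℕ → StrongDual 𝕜 X} (hf : f ∈ weakStarNullBall 𝕜 X)
    (h : ∀ k : ℕ → ℕ, k 0 = 0 → StrictMono k → ∃ x ∈ weaklyNullBall 𝕜 X,
      ∀ n, ∀ j ∈ Set.Ico (k n) (k (n + 1)), c ≤ RCLike.re (f j (x n))) :
    ENNReal.ofReal c ≤ K₂ 𝕜 X := by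
  refine le_iSup₂_of_le f hf (le_iInf₂ ?_)
  rintro g ⟨k, hk0, hk, hg⟩
  obtain ⟨x, hx, hfx⟩ := h k hk0 hk
  refine le_iSup₂_of_le x hx (le_limsup_of_frequently_le (.of_forall fun n => ?_))
  have hconv : Convex ℝ {φ : StrongDual 𝕜 X | c ≤ RCLike.re (φ (x n))} :=
    convex_halfSpace_ge ⟨fun φ ψ => by simp, fun r φ => by simp [RCLike.smul_re]⟩ c
  have hn : c ≤ RCLike.re (g n (x n)) := by
    refine convexHull_min ?_ hconv (hg n)
    rintro _ ⟨j, hj, rfl⟩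
    exact hfx n j hj
  rw [← ofReal_norm]
  exact ENNReal.ofReal_le_ofReal (hn.trans (RCLike.re_le_norm _))

theorem K₂_eq_one_of_forall {C : ℝ}
    (h : ∀ η : ℝ, 0 < η → ENNReal.ofReal (1 - C * η) ≤ K₂ 𝕜 X) : K₂ 𝕜 X = 1 := by
  refine le_antisymm K₂_le_one ?_
  have ht : Tendsto (fun η : ℝ => ENNReal.ofReal (1 - C * η)) (𝓝[>] 0)
      (𝓝 (ENNReal.ofReal (1 - C * 0))) :=
    (ENNReal.continuous_ofReal.comp
      (by fun_prop : Continuous fun η : ℝ => 1 - C * η)).continuousAt.mono_left nhdsWithin_le_nhds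
  rw [mul_zero, sub_zero, ENNReal.ofReal_one] at ht
  exact le_of_tendsto ht (eventually_nhdsWithin_of_forall fun η hη => h η hη)

end Test

section CZeroBounded

variable (𝕜 : Type*) [RCLike 𝕜] {X : Type*} [NormedAddCommGroup X] [NormedSpace 𝕜 X]

/-- The sequence `v` satisfies the upper `c₀`-estimate with constant one. -/
def IsCZeroBounded (v : ℕ → X) : Prop :=
  ∀ (p q : ℕ) (s : ℕ → 𝕜), (∀ i, ‖s i‖ ≤ 1) → ‖∑ i ∈ Finset.Ico p q, s i • v i‖ ≤ 1

variable {𝕜}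

theorem IsCZeroBounded.norm_map_sum_sub_le {v : ℕ → X} (hv : IsCZeroBounded 𝕜 v)
    {φ : StrongDual 𝕜 X} (hφ : ‖φ‖ ≤ 1) {p q i : ℕ} (hi : i ∈ Finset.Ico p q) {s : ℕ → 𝕜}
    (hs : ∀ i, ‖s i‖ ≤ 1) :
    ‖φ (∑ j ∈ Finset.Ico p q, s j • v j) - s i * φ (v i)‖ ≤ 1 - RCLike.re (φ (v i)) := by
  obtain ⟨u, hu, huz⟩ :=
    RCLike.exists_norm_eq_mul_self (φ (∑ j ∈ Finset.Ico p q, s j • v j) - s i * φ (v i))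
  have hb := hv p q (fun j => if j = i then 1 else u * s j) fun j => by
    split_ifs
    · simp
    · rw [norm_mul, hu, one_mul]; exact hs j
  have hsum : ∑ j ∈ Finset.Ico p q, (if j = i then 1 else u * s j) • v j
      = v i + u • (∑ j ∈ Finset.Ico p q, s j • v j - s i • v i) := by
    rw [← Finset.add_sum_erase _ _ hi, ← Finset.add_sum_erase _ (fun j => s j • v j) hi,
      add_sub_cancel_left, if_pos rfl, one_smul, Finset.smul_sum]
    congr 1
    refine Finset.sum_congr rfl fun j hj => ?_
    rw [if_neg (Finset.ne_of_mem_erase hj), mul_smul]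
  rw [hsum] at hb
  have h1 : RCLike.re (φ (v i + u • (∑ j ∈ Finset.Ico p q, s j • v j - s i • v i))) ≤ 1 :=
    (RCLike.re_le_norm _).trans ((φ.le_opNorm _).trans (mul_le_one₀ hφ (norm_nonneg _) hb))
  rw [map_add, map_smul, map_sub, map_smul, smul_eq_mul, smul_eq_mul, ← huz, map_add,
    RCLike.ofReal_re] at h1
  linarith

theorem IsCZeroBounded.blocks {v : ℕ → X} (hv : IsCZeroBounded 𝕜 v) {k : ℕ → ℕ}
    (hk : StrictMono k) {a : ℕ → ℕ → 𝕜} (ha : ∀ n i, ‖a n i‖ ≤ 1) :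
    IsCZeroBounded 𝕜 fun n => ∑ i ∈ Finset.Ico (k n) (k (n + 1)), a n i • v i := by
  intro p q s hs
  rcases lt_or_ge q p with h | h
  · rw [Finset.Ico_eq_empty (fun h' => (h.trans h').false)]
    simp
  · rw [sum_Ico_smul_blocks hk h (fun j _ => rfl)]
    refine hv _ _ _ fun i => ?_
    rw [norm_mul]
    exact mul_le_one₀ (hs _) (norm_nonneg _) (ha _ _)

theorem IsCZeroBounded.norm_le_one {v : ℕ → X} (hv : IsCZeroBounded 𝕜 v) (n : ℕ) :
    ‖v n‖ ≤ 1 := by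
  simpa using hv n (n + 1) (fun _ => 1) (by simp)

theorem IsCZeroBounded.mem_weaklyNullBall {v : ℕ → X} (hv : IsCZeroBounded 𝕜 v) :
    v ∈ weaklyNullBall 𝕜 X := by
  refine ⟨hv.norm_le_one, tendsto_toWeakSpace_zero_iff.2 fun φ => ?_⟩
  refine tendsto_zero_iff_norm_tendsto_zero.2 (Summable.tendsto_atTop_zero ?_)
  refine summable_of_sum_range_le (c := ‖φ‖) (fun _ => norm_nonneg _) fun n => ?_
  choose u hu huz using fun i => RCLike.exists_norm_eq_mul_self (φ (v i))
  have h : φ (∑ i ∈ Finset.Ico 0 n, u i • v i) = ((∑ i ∈ Finset.range n, ‖φ (v i)‖ : ℝ) : 𝕜) := by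
    rw [map_sum, Finset.range_eq_Ico, RCLike.ofReal_sum]
    exact Finset.sum_congr rfl fun i _ => by rw [map_smul, smul_eq_mul, huz]
  have hle := φ.le_of_opNorm_le_of_le le_rfl (hv 0 n u fun i => (hu i).le)
  rw [h, mul_one, RCLike.norm_ofReal] at hle
  exact (le_abs_self _).trans hle

theorem ofReal_le_K₂_of_isCZeroBounded {w : ℕ → X} (hw : IsCZeroBounded 𝕜 w)
    {f : ℕ → StrongDual 𝕜 X} (hf : f ∈ weakStarNullBall 𝕜 X) {η : ℝ}
    (hfw : ∀ n, 1 - η ≤ RCLike.re (f n (w n))) : ENNReal.ofReal (1 - 2 * η) ≤ K₂ 𝕜 X := by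
  refine ofReal_le_K₂_of_test hf fun k _ hk =>
    ⟨_, (hw.blocks hk (a := fun _ _ => 1) (by simp)).mem_weaklyNullBall, fun n j hj => ?_⟩
  have h := hw.norm_map_sum_sub_le (hf.1 j) (Finset.mem_Ico.2 hj) (s := fun _ => 1) (by simp)
  have h' := (abs_le.1 ((RCLike.abs_re_le_norm _).trans h)).1
  rw [map_sub, one_mul] at h'
  have := hfw j
  linarith

theorem ofReal_le_K₂_of_blockSeq {v : ℕ → X} (hv : IsCZeroBounded 𝕜 v)
    {φ : ℕ → StrongDual 𝕜 X} (hφ : ∀ n, ‖φ n‖ ≤ 1) {η : ℝ}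
    (hφv : ∀ n, 1 - η ≤ RCLike.re (φ n (v n))) {f : ℕ → StrongDual 𝕜 X}
    (hfφ : IsEllOneBlockSeq 𝕜 f φ) (hf : ∀ x, Tendsto (fun n => f n x) atTop (𝓝 0)) :
    ENNReal.ofReal (1 - 4 * η) ≤ K₂ 𝕜 X := by
  obtain ⟨k, hk, hfk⟩ := hfφ
  have hball : f ∈ weakStarNullBall 𝕜 X :=
    ⟨fun n => norm_le_of_mem_ellOneBlock (fun i _ => hφ i) (hfk n),
      tendsto_toWeakDual_zero_iff.2 hf⟩
  choose a ha hfa using hfk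
  choose u hu huz using fun n i => RCLike.exists_norm_eq_mul_self (a n i)
  rw [show 4 * η = 2 * (2 * η) by ring]
  refine ofReal_le_K₂_of_isCZeroBounded (hv.blocks hk fun n i => (hu n i).le) hball fun n => ?_
  have key : ∀ i ∈ Finset.Ico (k n) (k (n + 1)), ‖a n i‖ * (1 - 2 * η) ≤ RCLike.re
      (a n i * φ i (∑ j ∈ Finset.Ico (k n) (k (n + 1)), u n j • v j)) := fun i hi => by
    have h := hv.norm_map_sum_sub_le (hφ i) hi fun i => (hu n i).le
    have hη : 1 - RCLike.re (φ i (v i)) ≤ η := by linarith [hφv i]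
    set z := φ i (∑ j ∈ Finset.Ico (k n) (k (n + 1)), u n j • v j)
    have h1 : a n i * z = (‖a n i‖ : ℝ) * φ i (v i) + a n i * (z - u n i * φ i (v i)) := by
      rw [huz]; ring
    have h2 : ‖a n i * (z - u n i * φ i (v i))‖ ≤ ‖a n i‖ * η := by
      rw [norm_mul]
      exact mul_le_mul_of_nonneg_left (h.trans hη) (norm_nonneg _)
    rw [h1, map_add, RCLike.re_ofReal_mul]
    have h3 := (abs_le.1 ((RCLike.abs_re_le_norm _).trans h2)).1
    have h4 := mul_le_mul_of_nonneg_left (hφv i) (norm_nonneg (a n i))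
    linarith
  calc 1 - 2 * η = ∑ i ∈ Finset.Ico (k n) (k (n + 1)), ‖a n i‖ * (1 - 2 * η) := by
        rw [← Finset.sum_mul, ha, one_mul]
    _ ≤ _ := Finset.sum_le_sum key
    _ = _ := by
        rw [hfa, ← map_sum, sum_apply]
        rfl

theorem exists_ellOneBlockSeq_tendsto_zero {φ : ℕ → StrongDual 𝕜 X} {ψ : ℕ → ℕ}
    (hψ : StrictMono ψ) {l : X → 𝕜} (hl : ∀ x, Tendsto (fun n => φ (ψ n) x) atTop (𝓝 (l x))) :
    ∃ f : ℕ → StrongDual 𝕜 X,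
      IsEllOneBlockSeq 𝕜 f φ ∧ ∀ x, Tendsto (fun n => f n x) atTop (𝓝 0) := by
  refine ⟨_, (isEllOneBlockSeq_half_sub (φ ∘ ψ)).trans (isEllOneBlockSeq_subseq φ hψ),
    fun x => ?_⟩
  have h0 : Tendsto (fun n : ℕ => 2 * n) atTop atTop :=
    (strictMono_mul_left_of_pos two_pos).tendsto_atTop
  have h := (((hl x).comp h0).sub ((hl x).comp ((tendsto_add_atTop_nat 1).comp h0))).const_mul
    (2⁻¹ : 𝕜)
  rw [sub_self, mul_zero] at h
  exact h

theorem K₂_eq_one_of_tendsto {v : ℕ → X} (hv : IsCZeroBounded 𝕜 v)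
    {φ : ℕ → StrongDual 𝕜 X} (hφ : ∀ n, ‖φ n‖ ≤ 1) (hφv : ∀ n, φ n (v n) = 1) {l : X → 𝕜}
    (hl : ∀ x, Tendsto (fun n => φ n x) atTop (𝓝 (l x))) : K₂ 𝕜 X = 1 :=
  have ⟨_, hfφ, hf⟩ := exists_ellOneBlockSeq_tendsto_zero strictMono_id hl
  K₂_eq_one_of_forall fun _ hη =>
    ofReal_le_K₂_of_blockSeq hv hφ (fun n => by rw [hφv, RCLike.one_re]; linarith) hfφ hf

end CZeroBounded

section Spaces

variable {𝕜 : Type*} [RCLike 𝕜]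

theorem isCZeroBounded_of_disjoint_eval {X : Type*} [NormedAddCommGroup X] [NormedSpace 𝕜 X]
    {T : Type*} {e : T → X →ₗ[𝕜] 𝕜} (hnorm : ∀ x : X, (∀ t, ‖e t x‖ ≤ 1) → ‖x‖ ≤ 1) {v : ℕ → X}
    (hv : ∀ n t, ‖e t (v n)‖ ≤ 1) (hdisj : ∀ t i j, e t (v i) ≠ 0 → e t (v j) ≠ 0 → i = j) :
    IsCZeroBounded 𝕜 v := by
  intro p q s hs
  refine hnorm _ fun t => ?_
  rw [map_sum]
  by_cases h : ∃ i ∈ Finset.Ico p q, e t (v i) ≠ 0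
  · obtain ⟨i, hi, hne⟩ := h
    rw [Finset.sum_eq_single_of_mem i hi fun j _ hj => ?_]
    · rw [map_smul, smul_eq_mul, norm_mul]
      exact mul_le_one₀ (hs i) (norm_nonneg _) (hv i t)
    · rw [map_smul, smul_eq_mul]
      by_cases h0 : e t (v j) = 0
      · rw [h0, mul_zero]
      · exact absurd (hdisj t j i h0 hne) hj
  · push Not at h
    rw [Finset.sum_eq_zero fun i hi => by rw [map_smul, h i hi, smul_zero]]
    simp

end Spaces

section Spaces

variable (𝕜 : Type*) [RCLike 𝕜]

/-- The unit vectors of `c₀`. -/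
def SeqNull.unitVec (n : ℕ) : SeqNull 𝕜 where
  toFun := Pi.single n 1
  continuous_toFun := continuous_of_discreteTopology
  zero_at_infty' := by
    rw [cocompact_eq_cofinite]
    refine tendsto_nhds_of_eventually_eq ?_
    filter_upwards [(Set.finite_singleton n).compl_mem_cofinite] with m hm
    exact Pi.single_eq_of_ne hm _

variable {𝕜}

theorem SeqNull.unitVec_apply (n m : ℕ) :
    SeqNull.unitVec 𝕜 n m = if m = n then 1 else 0 :=
  Pi.single_apply n 1 m

theorem SeqNull.norm_apply_le (x : SeqNull 𝕜) (n : ℕ) : ‖x n‖ ≤ ‖x‖ := by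
  rw [← ZeroAtInftyContinuousMap.norm_toBCF_eq_norm]
  exact x.toBCF.norm_coe_le_norm n

theorem SeqNull.isCZeroBounded_unitVec : IsCZeroBounded 𝕜 (SeqNull.unitVec 𝕜) := by
  refine isCZeroBounded_of_disjoint_eval (T := ℕ)
    (e := fun t => { toFun := fun x => x t, map_add' := fun _ _ => rfl,
                     map_smul' := fun _ _ => rfl })
    (fun x hx => ?_) (fun n t => ?_) fun t i j hi hj => ?_
  · rw [← ZeroAtInftyContinuousMap.norm_toBCF_eq_norm]
    exact (BoundedContinuousFunction.norm_le zero_le_one).2 hx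
  · change ‖SeqNull.unitVec 𝕜 n t‖ ≤ 1
    rw [SeqNull.unitVec_apply]
    split_ifs <;> simp
  · change SeqNull.unitVec 𝕜 i t ≠ 0 at hi
    change SeqNull.unitVec 𝕜 j t ≠ 0 at hj
    rw [SeqNull.unitVec_apply, ne_eq, ite_eq_right_iff, Classical.not_imp] at hi hj
    exact hi.1.symm.trans hj.1

theorem K₂_seqNull : K₂ 𝕜 (SeqNull 𝕜) = 1 := by
  refine K₂_eq_one_of_tendsto SeqNull.isCZeroBounded_unitVec
    (φ := fun n => LinearMap.mkContinuous
      { toFun := fun x => x n, map_add' := fun _ _ => rfl, map_smul' := fun _ _ => rfl } 1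
      fun x => by simpa using SeqNull.norm_apply_le x n)
    (fun n => LinearMap.mkContinuous_norm_le _ zero_le_one _) (fun n => ?_) (l := 0) fun x => ?_
  · exact (SeqNull.unitVec_apply n n).trans (if_pos rfl)
  · have h := x.zero_at_infty'
    rw [cocompact_eq_cofinite, Nat.cofinite_eq_atTop] at h
    exact h

variable (𝕜) in
/-- The coordinate functionals of `c`. -/
noncomputable def SeqConv.coord (n : ℕ) : StrongDual 𝕜 (SeqConv 𝕜) :=
  (lp.evalCLM 𝕜 (fun _ : ℕ => 𝕜) ∞ n).comp (SeqConv 𝕜).subtypeL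

theorem SeqConv.coord_apply (n : ℕ) (x : SeqConv 𝕜) : SeqConv.coord 𝕜 n x = x.1 n :=
  rfl

theorem SeqConv.norm_coord_apply_le (n : ℕ) (x : SeqConv 𝕜) : ‖SeqConv.coord 𝕜 n x‖ ≤ ‖x‖ :=
  lp.norm_apply_le_norm ENNReal.top_ne_zero x.1 n

variable (𝕜) in
/-- The unit vectors of `c`. -/
def SeqConv.unitVec (n : ℕ) : SeqConv 𝕜 :=
  ⟨lp.single ∞ n (1 : 𝕜), 0, tendsto_nhds_of_eventually_eq <| by
    filter_upwards [eventually_gt_atTop n] with m hm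
    exact lp.single_apply_ne _ _ _ hm.ne'⟩

theorem SeqConv.coord_unitVec (n m : ℕ) :
    SeqConv.coord 𝕜 m (SeqConv.unitVec 𝕜 n) = if m = n then 1 else 0 := by
  rw [SeqConv.coord_apply]
  split_ifs with h
  · rw [h]
    exact lp.single_apply_self _ _ _
  · exact lp.single_apply_ne _ _ _ h

theorem K₂_seqConv : K₂ 𝕜 (SeqConv 𝕜) = 1 := by
  refine K₂_eq_one_of_tendsto (v := SeqConv.unitVec 𝕜)
    (isCZeroBounded_of_disjoint_eval (T := ℕ) (e := fun t => (SeqConv.coord 𝕜 t).toLinearMap)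
      (fun x hx => lp.norm_le_of_forall_le zero_le_one hx) (fun n t => ?_) fun t i j hi hj => ?_)
    (φ := SeqConv.coord 𝕜)
    (fun n => ContinuousLinearMap.opNorm_le_bound _ zero_le_one fun x => by
      rw [one_mul]; exact SeqConv.norm_coord_apply_le n x)
    (fun n => by rw [SeqConv.coord_unitVec, if_pos rfl])
    (l := fun x => x.2.choose) fun x => x.2.choose_spec
  · change ‖SeqConv.coord 𝕜 t (SeqConv.unitVec 𝕜 n)‖ ≤ 1
    rw [SeqConv.coord_unitVec]
    split_ifs <;> simp
  · change SeqConv.coord 𝕜 t (SeqConv.unitVec 𝕜 i) ≠ 0 at hi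
    change SeqConv.coord 𝕜 t (SeqConv.unitVec 𝕜 j) ≠ 0 at hj
    rw [SeqConv.coord_unitVec, ne_eq, ite_eq_right_iff, Classical.not_imp] at hi hj
    exact hi.1.symm.trans hj.1

/-- A tent function of height one around `2⁻ⁿ`. -/
noncomputable def tent (n : ℕ) (t : ℝ) : ℝ :=
  max 0 (1 - 4 * |2 ^ n * t - 1|)

theorem tent_le_one (n : ℕ) (t : ℝ) : tent n t ≤ 1 :=
  max_le zero_le_one (by linarith [abs_nonneg (2 ^ n * t - 1)])

theorem tent_ne_zero {n : ℕ} {t : ℝ} (h : tent n t ≠ 0) :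
    3 / 4 < 2 ^ n * t ∧ 2 ^ n * t < 5 / 4 := by
  have : 0 < 1 - 4 * |2 ^ n * t - 1| := by
    by_contra h'
    exact h (max_eq_left (not_lt.1 h'))
  have h1 := abs_lt.1 (show |2 ^ n * t - 1| < 1 / 4 by linarith)
  constructor <;> linarith

theorem tent_disjoint {i j : ℕ} {t : ℝ} (hi : tent i t ≠ 0) (hj : tent j t ≠ 0) : i = j := by
  by_contra hne
  wlog hij : i < j generalizing i j
  · exact this hj hi (Ne.symm hne) (by omega)
  have h1 := (tent_ne_zero hi).1
  have h2 := (tent_ne_zero hj).2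
  have ht : 0 < t := by
    by_contra h
    have := mul_nonpos_of_nonneg_of_nonpos (pow_nonneg (zero_le_two (α := ℝ)) i) (not_lt.1 h)
    linarith
  have h3 : (2 : ℝ) ^ (i + 1) ≤ 2 ^ j := pow_le_pow_right₀ one_le_two hij
  have h4 := mul_le_mul_of_nonneg_right h3 ht.le
  rw [pow_succ] at h4
  linarith

theorem K₂_continuousMap_unitInterval : K₂ 𝕜 C(unitInterval, 𝕜) = 1 := by
  have hcont : ∀ n, Continuous fun t : unitInterval => ((tent n t : ℝ) : 𝕜) := fun n =>
    RCLike.continuous_ofReal.comp (by unfold tent; fun_prop)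
  have hmem : ∀ n : ℕ, (2⁻¹ : ℝ) ^ n ∈ unitInterval := fun n =>
    ⟨by positivity, pow_le_one₀ (by norm_num) (by norm_num)⟩
  have htend : Tendsto (fun n => (⟨2⁻¹ ^ n, hmem n⟩ : unitInterval)) atTop (𝓝 0) :=
    tendsto_subtype_rng.2 (tendsto_pow_atTop_nhds_zero_of_lt_one (by norm_num) (by norm_num))
  refine K₂_eq_one_of_tendsto (v := fun n => (⟨_, hcont n⟩ : C(unitInterval, 𝕜)))
    (isCZeroBounded_of_disjoint_eval (T := unitInterval)
      (e := fun t => { toFun := fun x => x t, map_add' := fun _ _ => rfl,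
                       map_smul' := fun _ _ => rfl })
      (fun x hx => (ContinuousMap.norm_le x zero_le_one).2 hx) (fun n t => ?_)
      fun t i j hi hj => ?_)
    (φ := fun n => LinearMap.mkContinuous
      { toFun := fun x => x ⟨2⁻¹ ^ n, hmem n⟩, map_add' := fun _ _ => rfl,
        map_smul' := fun _ _ => rfl } 1
      fun x => by simpa using x.norm_coe_le_norm _)
    (fun n => LinearMap.mkContinuous_norm_le _ zero_le_one _) (fun n => ?_)
    (l := fun x => x 0) fun x => (x.continuous.tendsto 0).comp htend
  · change ‖((tent n t : ℝ) : 𝕜)‖ ≤ 1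
    rw [RCLike.norm_ofReal, abs_of_nonneg (le_max_left _ _)]
    exact tent_le_one n t
  · exact tent_disjoint (t := t) (fun h => hi (by simp [h])) fun h => hj (by simp [h])
  · change ((tent n (2⁻¹ ^ n) : ℝ) : 𝕜) = 1
    rw [tent, ← mul_pow]
    norm_num

end Spaces

section CZeroCopy

variable {𝕜 : Type*} [RCLike 𝕜] {X : Type*} [NormedAddCommGroup X] [NormedSpace 𝕜 X]

theorem sum_Ico_eq_sum_Ico_ite {M : Type*} [AddCommMonoid M] [Module 𝕜 M] {n p q : ℕ}
    (h : n ≤ p) (s : ℕ → 𝕜) (e : ℕ → M) :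
    ∑ i ∈ Finset.Ico p q, s i • e i
      = ∑ i ∈ Finset.Ico n q, (if p ≤ i then s i else 0) • e i := by
  simp_rw [ite_smul, zero_smul]
  rw [← Finset.sum_filter]
  refine Finset.sum_congr ?_ fun _ _ => rfl
  ext i
  simp only [Finset.mem_Ico, Finset.mem_filter]
  omega

/-- James' distortion theorem for `c₀`, upper estimate. -/
theorem exists_isCZeroBounded_of_le_norm {e : ℕ → X} {M m : ℝ}
    (hM : ∀ (p q : ℕ) (s : ℕ → 𝕜), (∀ i, ‖s i‖ ≤ 1) → ‖∑ i ∈ Finset.Ico p q, s i • e i‖ ≤ M)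
    (hm : 0 < m) (hme : ∀ n, m ≤ ‖e n‖) {η : ℝ} (hη : 0 < η) :
    ∃ v : ℕ → X, IsCZeroBounded 𝕜 v ∧ ∀ n, 1 - η ≤ ‖v n‖ := by
  wlog hη1 : η < 1 generalizing η
  · obtain ⟨v, hv, hvn⟩ := this (η := 1 / 2) (by norm_num) (by norm_num)
    exact ⟨v, hv, fun n => by linarith [hvn n]⟩
  have hle : ∀ {n q : ℕ} {K : ℝ}, (∀ (q : ℕ) (s : ℕ → 𝕜), (∀ i, ‖s i‖ ≤ 1) →
      ‖∑ i ∈ Finset.Ico n q, s i • e i‖ ≤ K) → m ≤ K := fun {n q K} h =>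
    (hme n).trans (by simpa using h (n + 1) (fun _ => 1) (by simp))
  obtain ⟨N, K, hK, hlow⟩ : ∃ (N : ℕ) (K : ℝ),
      (∀ (q : ℕ) (s : ℕ → 𝕜), (∀ i, ‖s i‖ ≤ 1) → ‖∑ i ∈ Finset.Ico N q, s i • e i‖ ≤ K) ∧
      ∀ n, ∃ (q : ℕ) (s : ℕ → 𝕜), (∀ i, ‖s i‖ ≤ 1) ∧
        (1 - η) * K < ‖∑ i ∈ Finset.Ico n q, s i • e i‖ := by
    by_contra! hcon
    have hiter : ∀ j : ℕ, ∃ n, ∀ (q : ℕ) (s : ℕ → 𝕜), (∀ i, ‖s i‖ ≤ 1) →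
        ‖∑ i ∈ Finset.Ico n q, s i • e i‖ ≤ (1 - η) ^ j * M := fun j => by
      induction j with
      | zero => exact ⟨0, fun q s hs => by simpa using hM 0 q s hs⟩
      | succ j ih =>
        obtain ⟨n, hn⟩ := ih
        obtain ⟨n', hn'⟩ := hcon n _ hn
        exact ⟨n', fun q s hs => (hn' q s hs).trans_eq (by ring)⟩
    have hM0 : 0 < M := hm.trans_le (hle (n := 0) (q := 0) fun q => hM 0 q)
    obtain ⟨j, hj⟩ := exists_pow_lt_of_lt_one (div_pos hm hM0) (show 1 - η < 1 by linarith)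
    obtain ⟨n, hn⟩ := hiter j
    have := hle (q := 0) hn
    rw [lt_div_iff₀ hM0] at hj
    linarith
  have hK0 : 0 < K := hm.trans_le (hle (q := 0) hK)
  choose Q s hs hQ using hlow
  have hQn : ∀ n, n < Q n := fun n => by
    by_contra h
    have := hQ n
    rw [Finset.Ico_eq_empty h, Finset.sum_empty, norm_zero] at this
    have := mul_nonneg (show 0 ≤ 1 - η by linarith) hK0.le
    linarith
  let k : ℕ → ℕ := fun n => Q^[n] N
  have hksucc : ∀ n, k (n + 1) = Q (k n) := fun n => Function.iterate_succ_apply' Q n N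
  have hk : StrictMono k := strictMono_nat_of_lt_succ fun n => by rw [hksucc]; exact hQn _
  refine ⟨fun j => (K : 𝕜)⁻¹ • ∑ i ∈ Finset.Ico (k j) (k (j + 1)), s (k j) i • e i, ?_,
    fun n => ?_⟩
  · intro p q t ht
    simp_rw [smul_comm _ (K : 𝕜)⁻¹, ← Finset.smul_sum]
    rw [norm_smul, norm_inv, RCLike.norm_ofReal, abs_of_pos hK0, inv_mul_le_one₀ hK0]
    rcases lt_or_ge q p with h | h
    · rw [Finset.Ico_eq_empty (fun h' => (h.trans h').false)]
      simpa using hK0.le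
    · rw [sum_Ico_smul_blocks hk h (a := fun j => s (k j)) (fun j _ => rfl),
        sum_Ico_eq_sum_Ico_ite (n := N) (hk.monotone p.zero_le)]
      refine hK _ _ fun i => ?_
      split_ifs
      · rw [norm_mul]
        exact mul_le_one₀ (ht _) (norm_nonneg _) (hs _ _)
      · simp
  · rw [norm_smul, norm_inv, RCLike.norm_ofReal, abs_of_pos hK0, hksucc, inv_mul_eq_div,
      le_div_iff₀ hK0]
    exact (hQ (k n)).le

theorem ContainsCopy.exists_isCZeroBounded (h : ContainsCopy 𝕜 X (SeqNull 𝕜)) {η : ℝ}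
    (hη : 0 < η) : ∃ v : ℕ → X, IsCZeroBounded 𝕜 v ∧ ∀ n, 1 - η ≤ ‖v n‖ := by
  obtain ⟨Y, -, ⟨T⟩⟩ := h
  have hT : ∀ x, ‖(T x : X)‖ ≤ ‖(T : SeqNull 𝕜 →L[𝕜] Y)‖ * ‖x‖ := fun x =>
    (T : SeqNull 𝕜 →L[𝕜] Y).le_opNorm x
  have hT' : ∀ x, ‖x‖ ≤ (‖(T.symm : Y →L[𝕜] SeqNull 𝕜)‖ + 1) * ‖(T x : X)‖ := fun x => by
    have h := (T.symm : Y →L[𝕜] SeqNull 𝕜).le_opNorm (T x)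
    simp only [ContinuousLinearEquiv.coe_coe, ContinuousLinearEquiv.symm_apply_apply] at h
    exact h.trans (mul_le_mul_of_nonneg_right (by linarith) (norm_nonneg _))
  have hpos : 0 < ‖(T.symm : Y →L[𝕜] SeqNull 𝕜)‖ + 1 := by positivity
  refine exists_isCZeroBounded_of_le_norm (e := fun n => (T (SeqNull.unitVec 𝕜 n) : X))
    (M := ‖(T : SeqNull 𝕜 →L[𝕜] Y)‖) (m := (‖(T.symm : Y →L[𝕜] SeqNull 𝕜)‖ + 1)⁻¹)
    (fun p q s hs => ?_) (inv_pos.2 hpos) (fun n => ?_) hη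
  · have hsum : ∑ i ∈ Finset.Ico p q, s i • (T (SeqNull.unitVec 𝕜 i) : X)
        = (T (∑ i ∈ Finset.Ico p q, s i • SeqNull.unitVec 𝕜 i) : X) := by
      simp
    rw [hsum]
    exact (hT _).trans (mul_le_of_le_one_right (norm_nonneg _)
      (SeqNull.isCZeroBounded_unitVec p q s hs))
  · rw [inv_le_iff_one_le_mul₀' hpos]
    refine le_trans ?_ (hT' _)
    have := SeqNull.norm_apply_le (SeqNull.unitVec 𝕜 n) n
    rwa [SeqNull.unitVec_apply, if_pos rfl, norm_one] at this

theorem K₂_eq_one_of_forall_blockSeq (hX : ContainsCopy 𝕜 X (SeqNull 𝕜))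
    (h : ∀ φ : ℕ → StrongDual 𝕜 X, (∀ n, ‖φ n‖ ≤ 1) → ∃ f : ℕ → StrongDual 𝕜 X,
      IsEllOneBlockSeq 𝕜 f φ ∧ ∀ x, Tendsto (fun n => f n x) atTop (𝓝 0)) : K₂ 𝕜 X = 1 := by
  refine K₂_eq_one_of_forall (C := 4) fun η hη => ?_
  obtain ⟨v, hv, hvn⟩ := hX.exists_isCZeroBounded hη
  choose φ hφ hφv using fun n => exists_dual_vector'' 𝕜 (v n)
  obtain ⟨f, hfφ, hf⟩ := h φ hφ
  exact ofReal_le_K₂_of_blockSeq hv hφ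
    (fun n => by rw [hφv, RCLike.ofReal_re]; exact hvn n) hfφ hf

theorem DualBallWeakStarSeqCompact.exists_blockSeq (h : DualBallWeakStarSeqCompact 𝕜 X)
    (φ : ℕ → StrongDual 𝕜 X) (hφ : ∀ n, ‖φ n‖ ≤ 1) : ∃ f : ℕ → StrongDual 𝕜 X,
      IsEllOneBlockSeq 𝕜 f φ ∧ ∀ x, Tendsto (fun n => f n x) atTop (𝓝 0) := by
  obtain ⟨l, -, ψ, hψ, hl⟩ := h (x := fun n => StrongDual.toWeakDual (φ n)) hφ
  exact exists_ellOneBlockSeq_tendsto_zero hψ fun x =>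
    ((WeakDual.eval_continuous x).tendsto l).comp hl

end CZeroCopy

section Stabilisation

variable {𝕜 : Type*} [RCLike 𝕜]

theorem IsEllOneBlockSeq.diagonal {E : Type*} [AddCommGroup E] [Module 𝕜 E] {y : ℕ → ℕ → E}
    (hy : ∀ m, IsEllOneBlockSeq 𝕜 (y (m + 1)) (y m)) {z : ℕ → E}
    (hz : IsEllOneBlockSeq 𝕜 z fun n => y n n) (m : ℕ) :
    IsEllOneBlockSeq 𝕜 (fun n => z (n + m)) (y m) := by
  choose k hk hyk using hy
  obtain ⟨t, ht, hzt⟩ := hz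
  let Q : ℕ → ℕ → ℕ := fun n => Nat.rec id (fun n q => if m ≤ n then q ∘ k n else q) n
  have hQs : ∀ n, Q (n + 1) = if m ≤ n then Q n ∘ k n else Q n := fun n => rfl
  have hQid : ∀ n ≤ m, Q n = id := fun n => by
    induction n with
    | zero => exact fun _ => rfl
    | succ n ih => exact fun hn => by rw [hQs, if_neg (by omega), ih (by omega)]
  have hQ : ∀ n, StrictMono (Q n) := fun n => by
    induction n with
    | zero => exact strictMono_id
    | succ n ih =>
      rw [hQs]
      split_ifs
      exacts [ih.comp (hk n), ih]
  have hyQ : ∀ n, m ≤ n → ∀ j, y n j ∈ ellOneBlock 𝕜 (y m) (Q n j) (Q n (j + 1)) := by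
    intro n hn
    induction n, hn using Nat.le_induction with
    | base =>
      rw [hQid m le_rfl]
      exact self_mem_ellOneBlock _
    | succ n hn ih =>
      rw [hQs, if_pos hn]
      exact fun j => mem_ellOneBlock_trans (hQ n) (fun i _ => ih i) (hyk n j)
  have hle : ∀ n, Q n (n + 1) ≤ Q (n + 1) (n + 1) := fun n => by
    rw [hQs]
    split_ifs
    exacts [(hQ n).monotone ((hk n).id_le _), le_rfl]
  have hp : StrictMono fun n => Q n n :=
    strictMono_nat_of_lt_succ fun n => (hQ n n.lt_succ_self).trans_le (hle n)
  refine ⟨fun n => Q (t (n + m)) (t (n + m)), hp.comp (ht.comp (strictMono_id.add_const m)),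
    fun n => ?_⟩
  have h := hzt (n + m)
  rw [add_right_comm] at h
  refine mem_ellOneBlock_trans (k := fun n => Q n n) hp (fun j hj => ?_) h
  have hmj : m ≤ j := ((Nat.le_add_left m n).trans (ht.id_le _)).trans (Finset.mem_Ico.1 hj).1
  exact ellOneBlock_mono le_rfl (hle j) (hyQ j hmj j)

variable {X : Type*} [NormedAddCommGroup X] [NormedSpace 𝕜 X]

/-- On each point of the unit ball the functionals `y n` are eventually bounded by `c`. -/
def IsEventuallyBounded (c : ℝ) (y : ℕ → StrongDual 𝕜 X) : Prop :=
  ∀ x, ‖x‖ ≤ 1 → ∀ᶠ n in atTop, ‖y n x‖ ≤ c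

theorem IsEventuallyBounded.nonneg {c : ℝ} {y : ℕ → StrongDual 𝕜 X}
    (h : IsEventuallyBounded c y) : 0 ≤ c := by
  obtain ⟨n, hn⟩ := (h 0 (by simp)).exists
  simpa using hn

theorem IsEventuallyBounded.mono {c c' : ℝ} {y : ℕ → StrongDual 𝕜 X}
    (h : IsEventuallyBounded c y) (hc : c ≤ c') : IsEventuallyBounded c' y :=
  fun x hx => (h x hx).mono fun _ hn => hn.trans hc

theorem IsEventuallyBounded.block {c : ℝ} {y z : ℕ → StrongDual 𝕜 X}
    (h : IsEventuallyBounded c y) (hz : IsEllOneBlockSeq 𝕜 z y) : IsEventuallyBounded c z := by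
  intro x hx
  obtain ⟨k, hk, hzk⟩ := hz
  obtain ⟨N, hN⟩ := eventually_atTop.1 (h x hx)
  refine eventually_atTop.2 ⟨N, fun n hn => ?_⟩
  exact norm_le_of_mem_ellOneBlock (fun i hi => hN i ((hn.trans (hk.id_le n)).trans hi))
    (map_mem_ellOneBlock (ContinuousLinearMap.apply 𝕜 𝕜 x).toLinearMap (hzk n))

theorem IsEventuallyBounded.of_add {c : ℝ} {y : ℕ → StrongDual 𝕜 X} {m : ℕ}
    (h : IsEventuallyBounded c fun n => y (n + m)) : IsEventuallyBounded c y := by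
  intro x hx
  obtain ⟨N, hN⟩ := eventually_atTop.1 (h x hx)
  refine eventually_atTop.2 ⟨N + m, fun n hn => ?_⟩
  have : ‖y (n - m + m) x‖ ≤ c := hN (n - m) (by omega)
  rwa [Nat.sub_add_cancel (by omega)] at this

theorem exists_stable_ellOneBlockSeq {φ : ℕ → StrongDual 𝕜 X} (hφ : ∀ n, ‖φ n‖ ≤ 1) :
    ∃ (y : ℕ → StrongDual 𝕜 X) (δ : ℝ), IsEllOneBlockSeq 𝕜 y φ ∧
      (∀ c, δ < c → IsEventuallyBounded c y) ∧
      ∀ z c, IsEllOneBlockSeq 𝕜 z y → c < δ → ¬ IsEventuallyBounded c z := by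
  let A : (ℕ → StrongDual 𝕜 X) → Set ℝ := fun y =>
    {c | ∃ z, IsEllOneBlockSeq 𝕜 z y ∧ IsEventuallyBounded c z}
  have hbdd : ∀ y, BddBelow (A y) := fun y => ⟨0, fun c ⟨z, _, hz⟩ => hz.nonneg⟩
  have hone : ∀ y : ℕ → StrongDual 𝕜 X, (∀ n, ‖y n‖ ≤ 1) → (1 : ℝ) ∈ A y := fun y hy =>
    ⟨y, .refl y, fun x hx => .of_forall fun n =>
      ((y n).le_opNorm x).trans (mul_le_one₀ (hy n) (norm_nonneg x) hx)⟩
  have hstep : ∀ (y : ℕ → StrongDual 𝕜 X) (m : ℕ), ∃ z, (∀ n, ‖y n‖ ≤ 1) →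
      IsEllOneBlockSeq 𝕜 z y ∧ IsEventuallyBounded (sInf (A y) + 1 / ((m : ℝ) + 1)) z := by
    intro y m
    by_cases hy : ∀ n, ‖y n‖ ≤ 1
    · obtain ⟨c, ⟨z, hz, hcz⟩, hc⟩ := exists_lt_of_csInf_lt ⟨1, hone y hy⟩
        (lt_add_of_pos_right (sInf (A y)) (Nat.one_div_pos_of_nat (α := ℝ) (n := m)))
      exact ⟨z, fun _ => ⟨hz, hcz.mono hc.le⟩⟩
    · exact ⟨y, fun h => absurd h hy⟩
  choose G hG using hstep
  let Y : ℕ → ℕ → StrongDual 𝕜 X := fun m => Nat.rec φ (fun m y => G y m) m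
  have hY1 : ∀ m n, ‖Y m n‖ ≤ 1 := fun m => by
    induction m with
    | zero => exact hφ
    | succ m ih =>
      obtain ⟨k, _, hk⟩ := (hG (Y m) m ih).1
      exact fun n => norm_le_of_mem_ellOneBlock (fun i _ => ih i) (hk n)
  have hYb : ∀ m, IsEllOneBlockSeq 𝕜 (Y (m + 1)) (Y m) := fun m => (hG (Y m) m (hY1 m)).1
  have hYc : ∀ m, IsEventuallyBounded (sInf (A (Y m)) + 1 / ((m : ℝ) + 1)) (Y (m + 1)) :=
    fun m => (hG (Y m) m (hY1 m)).2
  have hbddA : BddAbove (Set.range fun m => sInf (A (Y m))) := by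
    refine ⟨1, ?_⟩
    rintro _ ⟨m, rfl⟩
    exact csInf_le (hbdd _) (hone _ (hY1 m))
  refine ⟨fun n => Y n n, ⨆ m, sInf (A (Y m)), ?_, fun c hc => ?_, fun z c hz hc hcz => ?_⟩
  · exact IsEllOneBlockSeq.diagonal hYb (.refl _) 0
  · obtain ⟨m, hm⟩ := exists_nat_one_div_lt (sub_pos.2 hc)
    have h1 := le_ciSup hbddA m
    have h2 : sInf (A (Y m)) + 1 / ((m : ℝ) + 1) ≤ c := by linarith
    exact IsEventuallyBounded.of_add (y := fun n => Y n n) (m := m + 1)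
      (((hYc m).mono h2).block (IsEllOneBlockSeq.diagonal hYb (.refl _) (m + 1)))
  · obtain ⟨m, hm⟩ := exists_lt_of_lt_ciSup hc
    refine hm.not_ge (csInf_le (hbdd _) ⟨_, IsEllOneBlockSeq.diagonal hYb hz m, fun x hx => ?_⟩)
    exact (tendsto_add_atTop_nat m).eventually (hcz x hx)

theorem tendsto_zero_of_isEventuallyBounded {y : ℕ → StrongDual 𝕜 X}
    (h : ∀ c, 0 < c → IsEventuallyBounded c y) (x : X) :
    Tendsto (fun n => y n x) atTop (𝓝 0) := by
  have hpos : 0 < ‖x‖ + 1 := by positivity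
  refine Metric.tendsto_nhds.2 fun ε hε => ?_
  have hx : ‖((‖x‖ + 1 : ℝ) : 𝕜)⁻¹ • x‖ ≤ 1 := by
    rw [norm_smul, norm_inv, RCLike.norm_ofReal, abs_of_pos hpos, inv_mul_le_one₀ hpos]
    linarith
  filter_upwards [h (ε / 2 / (‖x‖ + 1)) (by positivity) _ hx] with n hn
  rw [map_smul, norm_smul, norm_inv, RCLike.norm_ofReal, abs_of_pos hpos, inv_mul_eq_div,
    div_le_div_iff_of_pos_right hpos] at hn
  rw [dist_zero_right]
  linarith

end Stabilisation

section EllOne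

variable {𝕜 : Type*} [RCLike 𝕜] {X : Type*} [NormedAddCommGroup X] [NormedSpace 𝕜 X]

theorem norm_sub_ofReal_le {δ τ m θ : ℝ} (hδ : 0 < δ) (hτ : 0 ≤ τ) (hτ1 : τ ≤ 1)
    (hθ : 0 ≤ θ) (hτθ : τ * (2 * δ + 1 + 6 * m * δ) ≤ θ ^ 2) {w : 𝕜} (hw : ‖w‖ ≤ δ + τ)
    (hre : δ - 3 * m * τ ≤ RCLike.re w) : ‖w - (δ : 𝕜)‖ ≤ θ := by
  refine (sq_le_sq₀ (norm_nonneg _) hθ).1 (le_trans ?_ hτθ)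
  have h1 := pow_le_pow_left₀ (norm_nonneg _) hw 2
  rw [RCLike.norm_sq_eq_def] at h1 ⊢
  simp only [map_sub, RCLike.ofReal_re, RCLike.ofReal_im, sub_zero]
  have h2 := mul_le_mul_of_nonneg_left hre (by positivity : 0 ≤ 2 * δ)
  have h3 := mul_le_mul_of_nonneg_left hτ1 hτ
  nlinarith

/-- In an average of numbers bounded by `δ + τ` which is at least `δ - 2 τ`, no term is small. -/
theorem le_of_le_sum {ι : Type*} {s : Finset ι} {g : ι → ℝ} {δ τ : ℝ} (hτ : 0 ≤ τ)
    (hg : ∀ i ∈ s, g i ≤ δ + τ) (hsum : (s.card : ℝ) * (δ - 2 * τ) ≤ ∑ i ∈ s, g i) {i : ι}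
    (hi : i ∈ s) : δ - 3 * s.card * τ ≤ g i := by
  classical
  have h := Finset.sum_le_card_nsmul (s.erase i) g (δ + τ) fun j hj =>
    hg j (Finset.mem_of_mem_erase hj)
  rw [Finset.card_erase_of_mem hi, nsmul_eq_mul,
    Nat.cast_sub (Finset.card_pos.2 ⟨i, hi⟩), Nat.cast_one] at h
  rw [← Finset.add_sum_erase _ _ hi] at hsum
  linarith

/-- A stable sequence of functionals takes prescribed values `t j * δ` along finitely many
infinite sets of indices at a single point of the unit ball. -/
theorem exists_forall_frequently_norm_sub_le {y : ℕ → StrongDual 𝕜 X} {δ : ℝ} (hδ : 0 < δ)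
    (hup : ∀ c, δ < c → IsEventuallyBounded c y)
    (hlow : ∀ z c, IsEllOneBlockSeq 𝕜 z y → c < δ → ¬ IsEventuallyBounded c z)
    {J : Type*} [Fintype J] [Nonempty J] {N : J → ℕ → Prop} (hN : ∀ j, ∃ᶠ k in atTop, N j k)
    {t : J → 𝕜} (ht : ∀ j, ‖t j‖ = 1) {θ : ℝ} (hθ : 0 < θ) :
    ∃ x, ‖x‖ ≤ 1 ∧ ∀ j, ∃ᶠ k in atTop, N j k ∧ ‖y k x - t j * (δ : 𝕜)‖ ≤ θ := by
  set m := Fintype.card J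
  have hm : 0 < m := Fintype.card_pos
  have hm' : (0 : ℝ) < m := Nat.cast_pos.2 hm
  let e : J ≃ Fin m := Fintype.equivFin J
  let π : ℕ → J := fun l => e.symm ⟨l % m, Nat.mod_lt l hm⟩
  have hπ : ∀ n j, n * m + e j ∈ Finset.Ico (n * m) ((n + 1) * m) ∧ π (n * m + e j) = j := by
    intro n j
    refine ⟨Finset.mem_Ico.2 ⟨Nat.le_add_right _ _, ?_⟩, ?_⟩
    · have := (e j).2
      rw [Nat.succ_mul]
      omega
    · have : (n * m + e j) % m = e j := by
        rw [Nat.mul_add_mod', Nat.mod_eq_of_lt (e j).2]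
      simp [π, this]
  obtain ⟨ν, hν, hNν⟩ := extraction_forall_of_frequently fun l => hN (π l)
  let τ : ℝ := min 1 (θ ^ 2 / (2 * δ + 1 + 6 * m * δ))
  have hτ : 0 < τ := lt_min one_pos (by positivity)
  have hτθ : τ * (2 * δ + 1 + 6 * m * δ) ≤ θ ^ 2 :=
    (le_div_iff₀ (by positivity)).1 (min_le_right _ _)
  let z : ℕ → StrongDual 𝕜 X := fun n => ∑ i ∈ Finset.Ico (n * m) ((n + 1) * m),
    ((m : 𝕜)⁻¹ * star (t (π i))) • y (ν i)
  have hz : IsEllOneBlockSeq 𝕜 z y := by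
    refine IsEllOneBlockSeq.trans (g := y ∘ ν) ⟨fun n => n * m,
      strictMono_nat_of_lt_succ fun n => by rw [Nat.succ_mul]; omega, fun n => ⟨_, ?_, rfl⟩⟩
      (isEllOneBlockSeq_subseq y hν)
    simp [ht, Nat.succ_mul, hm.ne']
  have hex := hlow z (δ - τ) hz (by linarith)
  unfold IsEventuallyBounded at hex
  push Not at hex
  obtain ⟨x, hx, hfreq⟩ := hex
  have hzup : ∀ᶠ n in atTop, ‖z n x‖ ≤ δ + τ := (hup (δ + τ) (by linarith)).block hz x hx
  have hclosed : IsClosed {w : 𝕜 | δ - τ ≤ ‖w‖ ∧ ‖w‖ ≤ δ + τ} :=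
    (isClosed_le continuous_const continuous_norm).inter
      (isClosed_le continuous_norm continuous_const)
  have hbdd : Bornology.IsBounded {w : 𝕜 | δ - τ ≤ ‖w‖ ∧ ‖w‖ ≤ δ + τ} :=
    (Metric.isBounded_closedBall (x := (0 : 𝕜)) (r := δ + τ)).subset fun w hw => by
      simpa using hw.2
  obtain ⟨ζ, hζ, φ, hφ, hlim⟩ := tendsto_subseq_of_frequently_bounded hbdd
    ((hfreq.and_eventually hzup).mono fun n hn => ⟨hn.1.le, hn.2⟩ :
      ∃ᶠ n in atTop, z n x ∈ {w : 𝕜 | δ - τ ≤ ‖w‖ ∧ ‖w‖ ≤ δ + τ})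
  rw [hclosed.closure_eq] at hζ
  obtain ⟨c, hc, hcζ⟩ := RCLike.exists_norm_eq_mul_self ζ
  have hcx : ‖c • x‖ ≤ 1 := by rwa [norm_smul, hc, one_mul]
  have hre : ∀ᶠ l in atTop, δ - 2 * τ < RCLike.re (z (φ l) (c • x)) := by
    have h1 : Tendsto (fun l => RCLike.re (z (φ l) (c • x))) atTop (𝓝 ‖ζ‖) := by
      have h2 := (RCLike.continuous_re.tendsto _).comp (hlim.const_mul c)
      rw [← hcζ, RCLike.ofReal_re] at h2
      refine h2.congr fun l => ?_
      simp only [Function.comp_apply, map_smul, smul_eq_mul]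
    exact h1.eventually (lt_mem_nhds (by linarith [hζ.1]))
  obtain ⟨L, hL⟩ := eventually_atTop.1 hre
  obtain ⟨K, hK⟩ := eventually_atTop.1 (hup (δ + τ) (by linarith) _ hcx)
  refine ⟨c • x, hcx, fun j => frequently_atTop.2 fun B => ?_⟩
  set l := max L (max K B)
  have hl : l ≤ φ l * m := (hφ.id_le l).trans (Nat.le_mul_of_pos_right _ hm)
  obtain ⟨hmem, hπj⟩ := hπ (φ l) j
  set i := φ l * m + e j
  have hνi : ∀ i ∈ Finset.Ico (φ l * m) ((φ l + 1) * m), l ≤ ν i := fun i hi =>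
    (hl.trans (Finset.mem_Ico.1 hi).1).trans (hν.id_le i)
  have hKB : K ≤ l ∧ B ≤ l := ⟨(le_max_left _ _).trans (le_max_right _ _),
    (le_max_right _ _).trans (le_max_right _ _)⟩
  refine ⟨ν i, hKB.2.trans (hνi i hmem), hπj ▸ hNν i, ?_⟩
  have hnorm : ∀ i, ‖star (t (π i)) * y (ν i) (c • x)‖ = ‖y (ν i) (c • x)‖ := fun i => by
    rw [norm_mul, norm_star, ht, one_mul]
  have hcard : (Finset.Ico (φ l * m) ((φ l + 1) * m)).card = m := by
    rw [Nat.card_Ico, Nat.succ_mul, Nat.add_sub_cancel_left]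
  have hzsum : (m : ℝ) * RCLike.re (z (φ l) (c • x))
      = ∑ i ∈ Finset.Ico (φ l * m) ((φ l + 1) * m),
          RCLike.re (star (t (π i)) * y (ν i) (c • x)) := by
    have h1 : z (φ l) (c • x) = ((m : ℝ) : 𝕜)⁻¹ *
        ∑ i ∈ Finset.Ico (φ l * m) ((φ l + 1) * m), star (t (π i)) * y (ν i) (c • x) := by
      simp only [z]
      rw [sum_apply, Finset.mul_sum]
      refine Finset.sum_congr rfl fun i _ => ?_
      rw [smul_apply, smul_eq_mul, mul_assoc, RCLike.ofReal_natCast]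
    rw [h1, ← RCLike.ofReal_inv, RCLike.re_ofReal_mul, map_sum, mul_inv_cancel_left₀ hm'.ne']
  have hge := le_of_le_sum (s := Finset.Ico (φ l * m) ((φ l + 1) * m)) hτ.le
    (fun i hi => (RCLike.re_le_norm _).trans
      ((hnorm i).trans_le (hK _ (hKB.1.trans (hνi i hi)))))
    (by
      rw [← hzsum, hcard]
      exact mul_le_mul_of_nonneg_left (hL l (le_max_left _ _)).le hm'.le) hmem
  rw [hcard] at hge
  have hfin := norm_sub_ofReal_le hδ hτ.le (min_le_left _ _) hθ.le hτθ
    ((hnorm i).trans_le (hK _ (hKB.1.trans (hνi i hmem)))) hge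
  have hunit : t (π i) * star (t (π i)) = 1 := by
    rw [RCLike.star_def, RCLike.mul_conj, ht]
    simp
  have hrw : y (ν i) (c • x) - t j * (δ : 𝕜)
      = t (π i) * (star (t (π i)) * y (ν i) (c • x) - δ) := by
    rw [mul_sub, ← mul_assoc, hunit, one_mul, hπj]
  rw [hrw, norm_mul, ht, one_mul]
  exact hfin

/-- The sign `±1` attached to a Boolean. -/
def boolSign (b : Bool) : ℝ :=
  if b then 1 else -1

theorem abs_boolSign (b : Bool) : |boolSign b| = 1 := by
  cases b <;> simp [boolSign]

/-- A stable sequence of functionals has a sequence of points on which it takes all patterns of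
approximate values `± δ`. -/
theorem exists_seq_forall_sign {y : ℕ → StrongDual 𝕜 X} {δ : ℝ} (hδ : 0 < δ)
    (hup : ∀ c, δ < c → IsEventuallyBounded c y)
    (hlow : ∀ z c, IsEllOneBlockSeq 𝕜 z y → c < δ → ¬ IsEventuallyBounded c z)
    {θ : ℝ} (hθ : 0 < θ) (hθδ : θ < δ) :
    ∃ v : ℕ → X, (∀ n, ‖v n‖ ≤ 1) ∧ ∀ (n : ℕ) (s : ℕ → Bool), ∃ k, ∀ i < n,
      ‖y k (v i) - (boolSign (s i) : 𝕜) * (δ : 𝕜)‖ ≤ θ := by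
  classical
  let Good : Finset X → Prop := fun F => ∀ s : X → Bool, ∃ᶠ k in atTop, ∀ x ∈ F,
    ‖y k x - (boolSign (s x) : 𝕜) * (δ : 𝕜)‖ ≤ θ
  have hstep : ∀ F : {F // Good F}, ∃ v, ‖v‖ ≤ 1 ∧ v ∉ F.1 ∧ Good (insert v F.1) := by
    rintro ⟨F, hF⟩
    let ext : (F → Bool) → X → Bool := fun s x => if h : x ∈ F then s ⟨x, h⟩ else true
    obtain ⟨v, hv, hfreq⟩ := exists_forall_frequently_norm_sub_le hδ hup hlow
      (J := (F → Bool) × Bool) (N := fun j k => ∀ x ∈ F,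
        ‖y k x - (boolSign (ext j.1 x) : 𝕜) * (δ : 𝕜)‖ ≤ θ)
      (fun j => hF (ext j.1)) (t := fun j => (boolSign j.2 : 𝕜))
      (fun j => by rw [RCLike.norm_ofReal, abs_boolSign]) hθ
    refine ⟨v, hv, fun hvF => ?_, fun s => ?_⟩
    · obtain ⟨k, hk1, hk2⟩ := (hfreq (fun _ => true, false)).exists
      have h1 := hk1 v hvF
      have h2 := norm_sub_le_of_le hk2 h1
      have h3 : y k v - (boolSign false : 𝕜) * (δ : 𝕜)
          - (y k v - (boolSign (ext (fun _ => true) v) : 𝕜) * (δ : 𝕜)) = ((2 * δ : ℝ) : 𝕜) := by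
        have : ext (fun _ => true) v = true := by simp [ext]
        rw [this]
        simp only [boolSign, if_true, Bool.false_eq_true, if_false]
        push_cast
        ring
      rw [h3, RCLike.norm_ofReal, abs_of_pos (by linarith)] at h2
      linarith
    · refine (hfreq (fun x => s x, s v)).mono fun k hk x hx => ?_
      rcases Finset.mem_insert.1 hx with rfl | hxF
      · exact hk.2
      · have := hk.1 x hxF
        simpa only [ext, dif_pos hxF] using this
  choose w hw hwF hwG using hstep
  let F : ℕ → {F // Good F} := fun n =>
    Nat.rec ⟨∅, fun s => by simpa using (atTop_neBot (α := ℕ))⟩ (fun _ F => ⟨_, hwG F⟩) n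
  have hFs : ∀ n, (F (n + 1)).1 = insert (w (F n)) (F n).1 := fun n => rfl
  have hmono : Monotone fun n => (F n).1 := monotone_nat_of_le_succ fun n => by
    rw [hFs]
    exact Finset.subset_insert _ _
  have hmem : ∀ {i n}, i < n → w (F i) ∈ (F n).1 := fun {i n} hin =>
    hmono (Nat.succ_le_of_lt hin) (Finset.mem_insert_self (w (F i)) (F i).1)
  have hinj : Function.Injective fun n => w (F n) := by
    intro i j hij
    by_contra hne
    wlog h : i < j generalizing i j
    · exact this hij.symm (Ne.symm hne) (by omega)
    have := hmem h
    rw [show w (F i) = w (F j) from hij] at this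
    exact hwF _ this
  refine ⟨fun n => w (F n), fun n => hw _, fun n s => ?_⟩
  obtain ⟨k, hk⟩ := ((F n).2 fun x => s (Function.invFun (fun n => w (F n)) x)).exists
  refine ⟨k, fun i hi => ?_⟩
  have := hk _ (hmem hi)
  rwa [Function.leftInverse_invFun hinj i] at this

theorem ellOne_lower_estimate {y : ℕ → StrongDual 𝕜 X} (hy : ∀ n, ‖y n‖ ≤ 1) {δ θ : ℝ}
    (hδ : 0 < δ) {v : ℕ → X}
    (hv : ∀ (n : ℕ) (s : ℕ → Bool), ∃ k, ∀ i < n,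
      ‖y k (v i) - (boolSign (s i) : 𝕜) * (δ : 𝕜)‖ ≤ θ) (c : ℕ → 𝕜) (n : ℕ) :
    (δ / 2 - θ) * ∑ i ∈ Finset.range n, ‖c i‖ ≤ ‖∑ i ∈ Finset.range n, c i • v i‖ := by
  have key : ∀ g : 𝕜 →ₗ[ℝ] ℝ, (∀ z, |g z| ≤ ‖z‖) →
      δ * ∑ i ∈ Finset.range n, |g (c i)| - θ * ∑ i ∈ Finset.range n, ‖c i‖
        ≤ ‖∑ i ∈ Finset.range n, c i • v i‖ := by
    intro g hg
    obtain ⟨k, hk⟩ := hv n fun i => decide (0 ≤ g (c i))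
    have hgs : ∀ i, boolSign (decide (0 ≤ g (c i))) * g (c i) = |g (c i)| := fun i => by
      by_cases h : 0 ≤ g (c i)
      · simp [boolSign, h, abs_of_nonneg h]
      · simp [boolSign, h, abs_of_neg (not_le.1 h)]
    set r : ℕ → ℝ := fun i => boolSign (decide (0 ≤ g (c i)))
    have h1 : g (∑ i ∈ Finset.range n, (r i * δ) • c i)
        = δ * ∑ i ∈ Finset.range n, |g (c i)| := by
      rw [map_sum, Finset.mul_sum]
      refine Finset.sum_congr rfl fun i _ => ?_
      rw [map_smul, smul_eq_mul, ← hgs]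
      ring
    have h2 : y k (∑ i ∈ Finset.range n, c i • v i) - ∑ i ∈ Finset.range n, (r i * δ) • c i
        = ∑ i ∈ Finset.range n, c i * (y k (v i) - (r i : 𝕜) * (δ : 𝕜)) := by
      rw [map_sum, ← Finset.sum_sub_distrib]
      refine Finset.sum_congr rfl fun i _ => ?_
      rw [map_smul, smul_eq_mul, RCLike.real_smul_eq_coe_mul]
      push_cast
      ring
    have h3 : ‖y k (∑ i ∈ Finset.range n, c i • v i) - ∑ i ∈ Finset.range n, (r i * δ) • c i‖
        ≤ θ * ∑ i ∈ Finset.range n, ‖c i‖ := by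
      rw [h2, mul_comm θ, Finset.sum_mul]
      refine norm_sum_le_of_le _ fun i hi => ?_
      rw [norm_mul]
      exact mul_le_mul_of_nonneg_left (hk i (Finset.mem_range.1 hi)) (norm_nonneg _)
    have h4 : ‖y k (∑ i ∈ Finset.range n, c i • v i)‖ ≤ ‖∑ i ∈ Finset.range n, c i • v i‖ := by
      simpa using (y k).le_of_opNorm_le (hy k) (∑ i ∈ Finset.range n, c i • v i)
    have h5 := (le_abs_self _).trans (hg (∑ i ∈ Finset.range n, (r i * δ) • c i))
    rw [h1] at h5
    have h6 := norm_sub_norm_le (∑ i ∈ Finset.range n, (r i * δ) • c i)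
      (y k (∑ i ∈ Finset.range n, c i • v i))
    rw [norm_sub_rev] at h6
    linarith
  have hre := key RCLike.reLm RCLike.abs_re_le_norm
  have him := key RCLike.imLm RCLike.abs_im_le_norm
  simp only [RCLike.reLm_coe, RCLike.imLm_coe] at hre him
  have hsum : ∑ i ∈ Finset.range n, ‖c i‖ ≤ ∑ i ∈ Finset.range n, |RCLike.re (c i)|
      + ∑ i ∈ Finset.range n, |RCLike.im (c i)| := by
    rw [← Finset.sum_add_distrib]
    refine Finset.sum_le_sum fun i _ => (sq_le_sq₀ (norm_nonneg _) (by positivity)).1 ?_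
    rw [RCLike.norm_sq_eq_def, add_sq, sq_abs, sq_abs]
    nlinarith [mul_nonneg (abs_nonneg (RCLike.re (c i))) (abs_nonneg (RCLike.im (c i)))]
  have := mul_le_mul_of_nonneg_left hsum hδ.le
  linarith

theorem lp_one_hasSum_norm {ι : Type*} {E : ι → Type*} [∀ i, NormedAddCommGroup (E i)]
    (a : lp E 1) : HasSum (fun i => ‖a i‖) ‖a‖ := by
  simpa using lp.hasSum_norm (p := 1) (by simp) a

theorem containsCopy_ellOne_of_lower_estimate [CompleteSpace X] {v : ℕ → X}
    (hv : ∀ n, ‖v n‖ ≤ 1) {η : ℝ} (hη : 0 < η)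
    (hlow : ∀ (c : ℕ → 𝕜) (n : ℕ),
      η * ∑ i ∈ Finset.range n, ‖c i‖ ≤ ‖∑ i ∈ Finset.range n, c i • v i‖) :
    ContainsCopy 𝕜 X (EllOne 𝕜) := by
  have hle : ∀ (a : EllOne 𝕜) (i : ℕ), ‖a i • v i‖ ≤ ‖a i‖ := fun a i => by
    rw [norm_smul]
    exact mul_le_of_le_one_right (norm_nonneg _) (hv i)
  have hsum : ∀ a : EllOne 𝕜, Summable fun i => a i • v i := fun a =>
    .of_norm_bounded (lp_one_hasSum_norm a).summable (hle a)
  let T : EllOne 𝕜 →L[𝕜] X := LinearMap.mkContinuous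
    { toFun := fun a => ∑' i, a i • v i
      map_add' := fun a b => by
        rw [← (hsum a).tsum_add (hsum b)]
        exact tsum_congr fun i => add_smul (a i) (b i) (v i)
      map_smul' := fun r a => by
        rw [RingHom.id_apply, ← (hsum a).tsum_const_smul]
        exact tsum_congr fun i => mul_smul r (a i) (v i) } 1 fun a => by
      rw [one_mul]
      exact tsum_of_norm_bounded (lp_one_hasSum_norm a) (hle a)
  have hT : ∀ a, η * ‖a‖ ≤ ‖T a‖ := fun a =>
    le_of_tendsto_of_tendsto' ((lp_one_hasSum_norm a).tendsto_sum_nat.const_mul η)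
      (hsum a).hasSum.tendsto_sum_nat.norm fun n => hlow a n
  have hanti : AntilipschitzWith (Real.toNNReal η⁻¹) T :=
    T.antilipschitz_of_bound fun a => by
      rw [Real.coe_toNNReal _ (inv_nonneg.2 hη.le), inv_mul_eq_div, le_div_iff₀ hη, mul_comm]
      exact hT a
  have hclosed : IsClosed (Set.range T) := hanti.isClosed_range T.uniformContinuous
  exact ⟨T.range, hclosed, ⟨T.equivRange hanti.injective hclosed⟩⟩

theorem exists_blockSeq_of_not_containsCopy_ellOne [CompleteSpace X]
    (hX : ¬ ContainsCopy 𝕜 X (EllOne 𝕜)) (φ : ℕ → StrongDual 𝕜 X) (hφ : ∀ n, ‖φ n‖ ≤ 1) :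
    ∃ f : ℕ → StrongDual 𝕜 X,
      IsEllOneBlockSeq 𝕜 f φ ∧ ∀ x, Tendsto (fun n => f n x) atTop (𝓝 0) := by
  obtain ⟨y, δ, hyφ, hup, hlow⟩ := exists_stable_ellOneBlockSeq hφ
  rcases le_or_gt δ 0 with hδ | hδ
  · exact ⟨y, hyφ, tendsto_zero_of_isEventuallyBounded fun c hc => hup c (hδ.trans_lt hc)⟩
  · obtain ⟨v, hv, hsign⟩ := exists_seq_forall_sign hδ hup hlow (θ := δ / 4) (by linarith)
      (by linarith)
    obtain ⟨k, _, hk⟩ := hyφ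
    exact absurd (containsCopy_ellOne_of_lower_estimate hv (show 0 < δ / 2 - δ / 4 by linarith)
      (ellOne_lower_estimate (fun n => norm_le_of_mem_ellOneBlock (fun i _ => hφ i) (hk n)) hδ
        hsign)) hX

theorem K₂_eq_one_of_containsCopy_seqNull [CompleteSpace X]
    (h : DualBallWeakStarSeqCompact 𝕜 X ∨ ¬ ContainsCopy 𝕜 X (EllOne 𝕜))
    (hX : ContainsCopy 𝕜 X (SeqNull 𝕜)) : K₂ 𝕜 X = 1 :=
  K₂_eq_one_of_forall_blockSeq hX <|
    h.elim DualBallWeakStarSeqCompact.exists_blockSeq exists_blockSeq_of_not_containsCopy_ellOne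

end EllOne

section Rademacher

open MeasureTheory

/-- The Rademacher functions, extended periodically to the real line. -/
noncomputable def rademacher (n : ℕ) (t : ℝ) : ℝ :=
  (-1) ^ ⌊2 ^ (n + 1) * t⌋

theorem abs_rademacher (n : ℕ) (t : ℝ) : |rademacher n t| = 1 := by
  simp [rademacher, abs_zpow]

theorem measurable_rademacher (n : ℕ) : Measurable (rademacher n) :=
  (Measurable.of_discrete (f := fun z : ℤ => (-1 : ℝ) ^ z)).comp
    (Int.measurable_floor.comp (measurable_const.mul measurable_id))

theorem rademacher_add_of_even {n j : ℕ} {c : ℝ} (hc : 2 ^ (n + 1) * c = ((2 * j : ℕ) : ℝ))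
    (t : ℝ) : rademacher n (t + c) = rademacher n t := by
  rw [rademacher, mul_add, hc, Int.floor_add_natCast, zpow_add₀ (by norm_num),
    zpow_natCast, pow_mul, neg_one_sq, one_pow, mul_one, rademacher]

theorem rademacher_add_half (n : ℕ) (t : ℝ) :
    rademacher n (t + (2 ^ (n + 1))⁻¹) = - rademacher n t := by
  rw [rademacher, mul_add, mul_inv_cancel₀ (by positivity), Int.floor_add_one,
    zpow_add_one₀ (by norm_num)]
  simp [rademacher]

theorem intervalIntegral_rademacher_mul {n m : ℕ} (h : n < m) :
    ∫ t in (0 : ℝ)..1, rademacher n t * rademacher m t = 0 := by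
  have hper : Function.Periodic (fun t => rademacher n t * rademacher m t) 1 := fun t => by
    have h1 : ∀ k, rademacher k (t + 1) = rademacher k t := fun k =>
      rademacher_add_of_even (j := 2 ^ k) (by push_cast; ring) t
    simp only [h1]
  have hshift : ∀ t, rademacher n (t + (2 ^ (n + 1))⁻¹) * rademacher m (t + (2 ^ (n + 1))⁻¹)
      = -(rademacher n t * rademacher m t) := fun t => by
    obtain ⟨d, rfl⟩ := Nat.exists_eq_add_of_lt h
    rw [rademacher_add_half, rademacher_add_of_even (j := 2 ^ d), neg_mul]
    rw [mul_inv_eq_iff_eq_mul₀ (by positivity)]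
    push_cast
    ring
  have h1 := hper.intervalIntegral_add_eq 0 (2 ^ (n + 1))⁻¹
  have h2 := intervalIntegral.integral_comp_add_right (a := 0) (b := 1)
    (fun t => rademacher n t * rademacher m t) (2 ^ (n + 1))⁻¹
  rw [zero_add, add_comm (1 : ℝ)] at h2
  simp only [hshift] at h2
  rw [← h2, intervalIntegral.integral_neg, zero_add] at h1
  linarith

theorem integral_unitInterval_eq {E : Type*} [NormedAddCommGroup E] [NormedSpace ℝ E]
    (F : ℝ → E) : ∫ t : unitInterval, F t = ∫ t in (0 : ℝ)..1, F t := by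
  rw [unitInterval.measurePreserving_coe.integral_comp unitInterval.measurableEmbedding_coe,
    intervalIntegral.integral_of_le zero_le_one, ← integral_Icc_eq_integral_Ioc]

end Rademacher

section Orthonormal

open MeasureTheory

variable {𝕜 : Type*} [RCLike 𝕜]

theorem Orthonormal.tendsto_inner_zero {H : Type*} [NormedAddCommGroup H] [InnerProductSpace 𝕜 H]
    {e : ℕ → H} (he : Orthonormal 𝕜 e) (x : H) :
    Tendsto (fun n => inner 𝕜 x (e n)) atTop (𝓝 0) := by
  refine tendsto_zero_iff_norm_tendsto_zero.2 ?_
  have h := (he.inner_products_summable (x := x)).tendsto_atTop_zero.sqrt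
  rw [Real.sqrt_zero] at h
  refine h.congr fun n => ?_
  rw [Real.sqrt_sq (norm_nonneg _), norm_inner_symm]

theorem isClosed_setOf_tendsto_zero {E : Type*} [NormedAddCommGroup E] [NormedSpace 𝕜 E]
    {R : ℕ → StrongDual 𝕜 E} (hR : ∀ n, ‖R n‖ ≤ 1) :
    IsClosed {x | Tendsto (fun n => R n x) atTop (𝓝 0)} := by
  refine isClosed_of_closure_subset fun x hx => Metric.tendsto_nhds.2 fun ε hε => ?_
  obtain ⟨y, hy, hxy⟩ := Metric.mem_closure_iff.1 hx (ε / 2) (half_pos hε)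
  filter_upwards [Metric.tendsto_nhds.1 hy (ε / 2) (half_pos hε)] with n hn
  rw [dist_zero_right] at hn ⊢
  rw [dist_eq_norm] at hxy
  have h1 : ‖R n (x - y)‖ ≤ ‖x - y‖ := by simpa using (R n).le_of_opNorm_le (hR n) (x - y)
  have h2 := norm_add_le (R n (x - y)) (R n y)
  rw [← map_add, sub_add_cancel] at h2
  linarith

variable {Ω : Type*} [MeasurableSpace Ω] {μ : Measure Ω}

variable (𝕜 μ) in
/-- The inclusion of `L₂` into `L₁` for a probability measure. -/
noncomputable def lpTwoToLpOne [IsProbabilityMeasure μ] : Lp 𝕜 2 μ →L[𝕜] Lp 𝕜 1 μ :=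
  LinearMap.mkContinuous
    { toFun := fun f => ((Lp.memLp f).mono_exponent one_le_two).toLp f
      map_add' := fun f g => by
        rw [← MemLp.toLp_add, MemLp.toLp_eq_toLp_iff]
        exact Lp.coeFn_add f g
      map_smul' := fun c f => by
        rw [RingHom.id_apply, ← MemLp.toLp_const_smul, MemLp.toLp_eq_toLp_iff]
        exact Lp.coeFn_smul c f } 1 fun f => by
    rw [one_mul]
    change ‖((Lp.memLp f).mono_exponent one_le_two).toLp f‖ ≤ ‖f‖
    rw [Lp.norm_toLp, Lp.norm_def]
    exact ENNReal.toReal_mono (Lp.eLpNorm_ne_top f)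
      (eLpNorm_le_eLpNorm_of_exponent_le one_le_two (Lp.aestronglyMeasurable f))

variable (𝕜 μ) in
/-- Integration against a bounded measurable function, as a functional on `L₁`. -/
noncomputable def integralAgainst (r : Ω → ℝ) (hr : Measurable r) (hr1 : ∀ t, |r t| = 1) :
    StrongDual 𝕜 (Lp 𝕜 1 μ) :=
  have hint : ∀ h : Lp 𝕜 1 μ, Integrable (fun t => (r t : 𝕜) * h t) μ := fun h =>
    (L1.integrable_coeFn h).bdd_mul (c := 1)
      (RCLike.measurable_ofReal.comp hr).aestronglyMeasurable
      (.of_forall fun t => by rw [RCLike.norm_ofReal, hr1])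
  LinearMap.mkContinuous
    { toFun := fun h => ∫ t, (r t : 𝕜) * h t ∂μ
      map_add' := fun f g => by
        rw [← integral_add (hint f) (hint g)]
        refine integral_congr_ae ((Lp.coeFn_add f g).mono fun t ht => ?_)
        simp only [ht, Pi.add_apply, mul_add]
      map_smul' := fun c f => by
        rw [RingHom.id_apply, ← integral_smul]
        refine integral_congr_ae ((Lp.coeFn_smul c f).mono fun t ht => ?_)
        simp only [ht, Pi.smul_apply, smul_eq_mul, mul_left_comm] } 1 fun h => by
    rw [one_mul, L1.norm_eq_integral_norm]
    refine (norm_integral_le_integral_norm _).trans_eq (integral_congr_ae (.of_forall fun t => ?_))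
    simp [hr1]

theorem integralAgainst_apply {r : Ω → ℝ} (hr : Measurable r) (hr1 : ∀ t, |r t| = 1)
    (h : Lp 𝕜 1 μ) : integralAgainst 𝕜 μ r hr hr1 h = ∫ t, (r t : 𝕜) * h t ∂μ :=
  rfl

theorem norm_integralAgainst_le {r : Ω → ℝ} (hr : Measurable r) (hr1 : ∀ t, |r t| = 1) :
    ‖integralAgainst 𝕜 μ r hr hr1‖ ≤ 1 := by
  unfold integralAgainst
  exact LinearMap.mkContinuous_norm_le _ zero_le_one _

variable [IsProbabilityMeasure μ]

variable (𝕜 μ) in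
theorem memLp_ofReal {r : Ω → ℝ} (hr : Measurable r) (hr1 : ∀ t, |r t| = 1) (p : ℝ≥0∞) :
    MemLp (fun t => (r t : 𝕜)) p μ :=
  .of_bound (RCLike.measurable_ofReal.comp hr).aestronglyMeasurable 1
    (.of_forall fun t => by rw [RCLike.norm_ofReal, hr1])

variable {r : ℕ → Ω → ℝ} (hr : ∀ n, Measurable (r n)) (hr1 : ∀ n t, |r n t| = 1)

theorem orthonormal_toLp (hr0 : ∀ n m, n ≠ m → ∫ t, r n t * r m t ∂μ = 0) :
    Orthonormal 𝕜 fun n => (memLp_ofReal 𝕜 μ (hr n) (hr1 n) 2).toLp := by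
  have hinner : ∀ n m, inner 𝕜 (memLp_ofReal 𝕜 μ (hr n) (hr1 n) 2).toLp
      (memLp_ofReal 𝕜 μ (hr m) (hr1 m) 2).toLp = ((∫ t, r n t * r m t ∂μ : ℝ) : 𝕜) := by
    intro n m
    rw [L2.inner_def, ← integral_ofReal]
    refine integral_congr_ae ?_
    filter_upwards [(memLp_ofReal 𝕜 μ (hr n) (hr1 n) 2).coeFn_toLp,
      (memLp_ofReal 𝕜 μ (hr m) (hr1 m) 2).coeFn_toLp] with t h1 h2
    rw [h1, h2, RCLike.inner_apply, RCLike.conj_ofReal, mul_comm]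
    push_cast
    rfl
  rw [orthonormal_iff_ite]
  intro n m
  rw [hinner]
  split_ifs with h
  · subst h
    simp [← abs_mul_abs_self (r n _), hr1]
  · rw [hr0 n m h, RCLike.ofReal_zero]

theorem tendsto_dual_toLp_zero (hr0 : ∀ n m, n ≠ m → ∫ t, r n t * r m t ∂μ = 0)
    (φ : StrongDual 𝕜 (Lp 𝕜 1 μ)) :
    Tendsto (fun n => φ (memLp_ofReal 𝕜 μ (hr n) (hr1 n) 1).toLp) atTop (𝓝 0) := by
  obtain ⟨w, hw⟩ := (InnerProductSpace.toDual 𝕜 (Lp 𝕜 2 μ)).surjective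
    (φ.comp (lpTwoToLpOne 𝕜 μ))
  refine ((orthonormal_toLp hr hr1 hr0).tendsto_inner_zero w).congr fun n => ?_
  rw [← InnerProductSpace.toDual_apply_apply, hw]
  refine congrArg φ ?_
  change MemLp.toLp _ ((Lp.memLp (memLp_ofReal 𝕜 μ (hr n) (hr1 n) 2).toLp).mono_exponent
    one_le_two) = _
  rw [MemLp.toLp_eq_toLp_iff]
  exact MemLp.coeFn_toLp _

theorem tendsto_integralAgainst_zero (hr0 : ∀ n m, n ≠ m → ∫ t, r n t * r m t ∂μ = 0)
    (h : Lp 𝕜 1 μ) :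
    Tendsto (fun n => integralAgainst 𝕜 μ (r n) (hr n) (hr1 n) h) atTop (𝓝 0) := by
  refine Lp.induction ENNReal.one_ne_top
    (motive := fun h => Tendsto (fun n => integralAgainst 𝕜 μ (r n) (hr n) (hr1 n) h) atTop (𝓝 0))
    (fun c s hs hμs => ?_) (fun f g hf hg _ hf0 hg0 => ?_)
    (isClosed_setOf_tendsto_zero fun n => norm_integralAgainst_le _ _) h
  · have h1 := ((orthonormal_toLp hr hr1 hr0).tendsto_inner_zero
      (indicatorConstLp 2 hs hμs.ne (1 : 𝕜))).mul_const c
    rw [zero_mul] at h1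
    refine h1.congr fun n => ?_
    rw [L2.inner_indicatorConstLp_one, integralAgainst_apply, Lp.simpleFunc.coe_indicatorConst,
      ← integral_mul_const, ← integral_indicator hs]
    refine integral_congr_ae ?_
    filter_upwards [(memLp_ofReal 𝕜 μ (hr n) (hr1 n) 2).coeFn_toLp,
      indicatorConstLp_coeFn (p := 1) (hs := hs) (hμs := hμs.ne) (c := c)] with t h2 h3
    rw [h3]
    by_cases ht : t ∈ s
    · simp [ht, h2]
    · simp [ht]
  · simpa using hf0.add hg0

end Orthonormal

section EllOneSum

open MeasureTheory

variable {𝕜 : Type*} [RCLike 𝕜] {ι : Type*} {E : Type*} [NormedAddCommGroup E] [NormedSpace 𝕜 E]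

theorem summable_dual_apply {φ : ι → StrongDual 𝕜 E} (hφ : ∀ i, ‖φ i‖ ≤ 1)
    (x : lp (fun _ : ι => E) 1) : Summable fun i => φ i (x i) :=
  .of_norm_bounded (lp_one_hasSum_norm x).summable fun i => by
    simpa using (φ i).le_of_opNorm_le (hφ i) (x i)

/-- The functional on an `ℓ₁`-sum with given components in the unit ball of the dual. -/
noncomputable def ellOneSumDual (φ : ι → StrongDual 𝕜 E) (hφ : ∀ i, ‖φ i‖ ≤ 1) :
    StrongDual 𝕜 (lp (fun _ : ι => E) 1) :=
  LinearMap.mkContinuous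
    { toFun := fun x => ∑' i, φ i (x i)
      map_add' := fun x y => by
        rw [← (summable_dual_apply hφ x).tsum_add (summable_dual_apply hφ y)]
        exact tsum_congr fun i => map_add (φ i) (x i) (y i)
      map_smul' := fun c x => by
        rw [RingHom.id_apply, ← (summable_dual_apply hφ x).tsum_const_smul]
        exact tsum_congr fun i => map_smul (φ i) c (x i) } 1 fun x => by
    rw [one_mul]
    exact tsum_of_norm_bounded (lp_one_hasSum_norm x) fun i => by
      simpa using (φ i).le_of_opNorm_le (hφ i) (x i)

theorem ellOneSumDual_apply (φ : ι → StrongDual 𝕜 E) (hφ : ∀ i, ‖φ i‖ ≤ 1)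
    (x : lp (fun _ : ι => E) 1) : ellOneSumDual φ hφ x = ∑' i, φ i (x i) :=
  rfl

theorem norm_ellOneSumDual_le (φ : ι → StrongDual 𝕜 E) (hφ : ∀ i, ‖φ i‖ ≤ 1) :
    ‖ellOneSumDual φ hφ‖ ≤ 1 :=
  LinearMap.mkContinuous_norm_le _ zero_le_one _

theorem ellOneSumDual_single [DecidableEq ι] (φ : ι → StrongDual 𝕜 E) (hφ : ∀ i, ‖φ i‖ ≤ 1)
    (i : ι) (x : E) : ellOneSumDual φ hφ (lp.single 1 i x) = φ i x := by
  rw [ellOneSumDual_apply, tsum_eq_single i, lp.single_apply_self]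
  intro j hj
  rw [lp.single_apply_ne _ _ _ hj, map_zero]

/-- If `E` carries a weakly null sequence `x` and a weak* null sequence `R` in the unit balls with
`R n (x n) = 1`, then an `ℓ₁`-sum of at least continuum many copies of `E` has `K₂` equal to one:
each sequence of block ends gets its own coordinate. -/
theorem K₂_ellOneSum_eq_one {x : ℕ → E} (hx : x ∈ weaklyNullBall 𝕜 E)
    {R : ℕ → StrongDual 𝕜 E} (hR : R ∈ weakStarNullBall 𝕜 E) (hRx : ∀ n, R n (x n) = 1)
    (hι : Cardinal.continuum ≤ Cardinal.mk ι) : K₂ 𝕜 (lp (fun _ : ι => E) 1) = 1 := by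
  classical
  have hcard : Cardinal.lift.{u_2} (Cardinal.mk {k : ℕ → ℕ // StrictMono k})
      ≤ Cardinal.lift.{0} (Cardinal.mk ι) := by
    rw [Cardinal.lift_uzero]
    refine le_trans (Cardinal.lift_le.2 (Cardinal.mk_subtype_le _)) ?_
    simpa using hι
  obtain ⟨g⟩ := Cardinal.lift_mk_le'.1 hcard
  have : Nonempty {k : ℕ → ℕ // StrictMono k} := ⟨⟨id, strictMono_id⟩⟩
  obtain ⟨κ, hκ⟩ : ∃ κ : ι → {k : ℕ → ℕ // StrictMono k}, Function.Surjective κ :=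
    ⟨Function.invFun g, Function.invFun_surjective g.injective⟩
  let f : ℕ → StrongDual 𝕜 (lp (fun _ : ι => E) 1) := fun j =>
    ellOneSumDual (fun i => R (blockIndex (κ i).1 j)) fun i => hR.1 _
  have hf : f ∈ weakStarNullBall 𝕜 (lp (fun _ : ι => E) 1) := by
    refine ⟨fun j => norm_ellOneSumDual_le _ _, tendsto_toWeakDual_zero_iff.2 fun y => ?_⟩
    have h := tendsto_tsum_of_dominated_convergence (𝓕 := atTop)
      (f := fun j i => R (blockIndex (κ i).1 j) (y i)) (g := fun _ => (0 : 𝕜))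
      (lp_one_hasSum_norm y).summable
      (fun i => (tendsto_toWeakDual_zero_iff.1 hR.2 (y i)).comp (tendsto_blockIndex (κ i).2))
      (.of_forall fun j i => by
        simpa using (R (blockIndex (κ i).1 j)).le_of_opNorm_le (hR.1 _) (y i))
    rwa [tsum_zero] at h
  refine K₂_eq_one_of_forall (C := 0) fun η _ => ?_
  rw [zero_mul, sub_zero]
  refine ofReal_le_K₂_of_test hf fun k _ hk => ?_
  obtain ⟨i, hi⟩ := hκ ⟨k, hk⟩
  refine ⟨fun n => lp.single 1 i (x n), ⟨fun n => ?_, ?_⟩, fun n j hj => ?_⟩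
  · rw [lp.norm_single one_pos]
    exact hx.1 n
  · exact tendsto_toWeakSpace_zero_iff.2 fun φ => tendsto_toWeakSpace_zero_iff.1 hx.2
      (φ.comp (lp.singleContinuousLinearMap 𝕜 (fun _ : ι => E) 1 i))
  · simp only [f]
    rw [ellOneSumDual_single, hi, blockIndex_eq hk (Finset.mem_Ico.2 hj), hRx, RCLike.one_re]

theorem K₂_ellOneSumLOne (hι : Cardinal.continuum ≤ Cardinal.mk ι) :
    K₂ 𝕜 (EllOneSumLOne 𝕜 ι) = 1 := by
  let r : ℕ → unitInterval → ℝ := fun n t => rademacher n t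
  have hr : ∀ n, Measurable (r n) := fun n => (measurable_rademacher n).comp measurable_subtype_coe
  have hr1 : ∀ n t, |r n t| = 1 := fun n t => abs_rademacher n t
  have hr0 : ∀ n m, n ≠ m → ∫ t, r n t * r m t = 0 := fun n m hnm => by
    wlog h : n < m generalizing n m
    · simp_rw [mul_comm (r n _)]
      exact this m n hnm.symm (by omega)
    exact (integral_unitInterval_eq fun t => rademacher n t * rademacher m t).trans
      (intervalIntegral_rademacher_mul h)
  refine K₂_ellOneSum_eq_one (x := fun n => (memLp_ofReal 𝕜 volume (hr n) (hr1 n) 1).toLp)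
    (R := fun n => integralAgainst 𝕜 volume (r n) (hr n) (hr1 n))
    ⟨fun n => ?_, tendsto_toWeakSpace_zero_iff.2 (tendsto_dual_toLp_zero hr hr1 hr0)⟩
    ⟨fun n => norm_integralAgainst_le _ _,
      tendsto_toWeakDual_zero_iff.2 (tendsto_integralAgainst_zero hr hr1 hr0)⟩ (fun n => ?_) hι
  · rw [L1.norm_eq_integral_norm]
    refine (integral_congr_ae ?_).trans_le (b := ∫ _ : unitInterval, (1 : ℝ)) (by simp)
    filter_upwards [(memLp_ofReal 𝕜 volume (hr n) (hr1 n) 1).coeFn_toLp] with t ht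
    rw [ht, RCLike.norm_ofReal, hr1]
  · rw [integralAgainst_apply]
    refine (integral_congr_ae ?_).trans (b := ∫ _ : unitInterval, (1 : 𝕜)) (by simp)
    filter_upwards [(memLp_ofReal 𝕜 volume (hr n) (hr1 n) 1).coeFn_toLp] with t ht
    rw [ht, ← RCLike.ofReal_mul, ← abs_mul_abs_self, hr1, mul_one, RCLike.ofReal_one]

end EllOneSum

theorem mainTheorem11 (𝕜 : Type*) [RCLike 𝕜] :
    (∀ (X : Type*) [NormedAddCommGroup X] [NormedSpace 𝕜 X] [CompleteSpace X],
      (DualBallWeakStarSeqCompact 𝕜 X ∨ ¬ ContainsCopy 𝕜 X (EllOne 𝕜)) →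
      ContainsCopy 𝕜 X (SeqNull 𝕜) → K₂ 𝕜 X = 1) ∧
    (K₂ 𝕜 (SeqNull 𝕜) = 1 ∧ K₂ 𝕜 (SeqConv 𝕜) = 1 ∧ K₂ 𝕜 C(unitInterval, 𝕜) = 1) ∧
    (∀ ι : Type*, Cardinal.mk ι = Cardinal.continuum → K₂ 𝕜 (EllOneSumLOne 𝕜 ι) = 1) :=
  ⟨fun _ _ _ _ => K₂_eq_one_of_containsCopy_seqNull,
    ⟨K₂_seqNull, K₂_seqConv, K₂_continuousMap_unitInterval⟩,
    fun _ hι => K₂_ellOneSumLOne hι.ge⟩
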